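/- **Definitions.** Let $\beta>1$ be a non-integer real number and let $T_\beta(x)=\{\beta x\}$ (fractional part). Put $t_0=-1$ and $t_i=\lfloor \beta\, T_\beta^{\,i-1}(1)\rfloor$ for $i\ge 1$, so that $d_\beta(1)=0.t_1t_2t_3\ldots$ is the Rényi $\beta$-expansion of $1$. The number $\beta$ is a *Parry number* if $(t_i)_{i\ge1}$ is finite (i.e. ends in infinitely many zeros) or eventually periodic; it is *simple* if the expansion is finite. If $\beta$ is simple, let $m$ be the length of the expansion, $d_\beta(1)=0.t_1\ldots t_m$ with $t_m\neq0$; the *Parry polynomial* of $\beta$ is then $$n_\beta^*(X)=X^m-\sum_{j=1}^{m}t_jX^{m-j}.$$ If $\beta$ is a non-simple Parry number, let $m\ge0$ be the (minimal) preperiod length and $p+1\ge1$ the (minimal) period length of $(t_i)_{i\ge1}$; the Parry polynomial is then $$n_\beta^*(X)=X^{m+p+1}-\sum_{j=1}^{m+p+1}t_jX^{m+p+1-j}-X^m+\sum_{j=1}^{m}t_jX^{m-j}.$$ A polynomial $R\in\mathbb Z[X]$ is *reciprocal* if $R(X)=X^{\deg R}R(1/X)$. For $Q=\sum_j\alpha_jX^j$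 let $\|Q\|_2=\left(\sum_j|\alpha_j|^2\right)^{1/2}$. A *Pisot number* is a real algebraic integer $\theta>1$ all of whose other Galois conjugates have modulus $<1$. Let $P_\beta\in\mathbb Z[X]$ denote the minimal polynomial of $\beta$. **Theorem.** There is a smallest Pisot number $\theta_0=1.3247\ldots$; it is the dominant root of $X^3-X-1$ (a real root, all other complex roots having strictly smaller modulus), and the following hold. 1. For every Parry number $\beta$, the number of non-reciprocal irreducible factors of $n_\beta^*$ in $\mathbb Z[X]$, counted with multiplicity, is strictly less than $$\frac{\log\|n_\beta^*\|_2}{\log\theta_0}.$$ 2. Let $\beta$ be a Parry number whose minimal polynomial $P_\beta$ is non-reciprocal. Suppose that $$\sum_{j=0}^{m}t_j^2\le\theta_0^4\quad\text{if }\beta\text{ is simple},$$ $$\sum_{j=0}^{p}t_j^2+(1+t_{p+1})^2+\sum_{j=1}^{m}(t_j-t_{p+j+1})^2\le\theta_0^4\quad\text{if }\beta\text{ is non-simple}.$$ Then $P_\beta$ is the only non-reciprocal irreducible factor of $n_\beta^*$ (up to sign), and it occurs with multiplicity one. -/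

import Mathlib

open Polynomial

/-- The beta-transformation `T_β(x) = {β x}`. -/
noncomputable def betaTransformation (β x : ℝ) : ℝ := Int.fract (β * x)

/-- The digits `t_i = ⌊β T_β^{i-1}(1)⌋` (`i ≥ 1`) of the Rényi `β`-expansion
`d_β(1) = 0.t₁t₂t₃…` of `1`, together with the convention `t₀ = -1`. -/
noncomputable def renyiDigit (β : ℝ) : ℕ → ℤ
  | 0 => -1
  | i + 1 => ⌊β * (betaTransformation β)^[i] 1⌋

/-- `d_β(1)` is finite: it ends in infinitely many zeros. -/
def HasFiniteExpansion (β : ℝ) : Prop :=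
  ∃ m : ℕ, ∀ i > m, renyiDigit β i = 0

/-- `d_β(1)` is eventually periodic. -/
def HasEventuallyPeriodicExpansion (β : ℝ) : Prop :=
  ∃ m : ℕ, ∃ L ≥ 1, ∀ i > m, renyiDigit β (i + L) = renyiDigit β i

/-- Parry numbers: non-integer real numbers `β > 1` for which `d_β(1)` is finite or
eventually periodic. -/
def IsParryNumber (β : ℝ) : Prop :=
  1 < β ∧ (∀ n : ℤ, β ≠ n) ∧ (HasFiniteExpansion β ∨ HasEventuallyPeriodicExpansion β)

/-- The length `m` of a finite expansion `d_β(1) = 0.t₁…t_m` (with `t_m ≠ 0`). -/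
noncomputable def expansionLength (β : ℝ) : ℕ :=
  sInf {m : ℕ | ∀ i > m, renyiDigit β i = 0}

/-- The preperiod length `m ≥ 0` of an eventually periodic expansion `d_β(1)`. -/
noncomputable def preperiodLength (β : ℝ) : ℕ :=
  sInf {m : ℕ | ∃ L ≥ 1, ∀ i > m, renyiDigit β (i + L) = renyiDigit β i}

/-- The period length (usually written `p + 1`) of an eventually periodic expansion `d_β(1)`. -/
noncomputable def periodLength (β : ℝ) : ℕ :=
  sInf {L : ℕ | L ≥ 1 ∧ ∀ i > preperiodLength β, renyiDigit β (i + L) = renyiDigit β i}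

/-- The Parry polynomial of a simple Parry number:
`X^m - t₁ X^{m-1} - … - t_m`. -/
noncomputable def simpleParryPolynomial (β : ℝ) : ℤ[X] :=
  X ^ expansionLength β -
    ∑ j ∈ Finset.Icc 1 (expansionLength β), C (renyiDigit β j) * X ^ (expansionLength β - j)

/-- The Parry polynomial of a non-simple Parry number, with preperiod length `m` and period
length `L`:
`X^{m+L} - t₁ X^{m+L-1} - … - t_{m+L} - X^m + t₁ X^{m-1} + … + t_m`.
For `m = 0` this is `X^L - t₁ X^{L-1} - … - t_{L-1} X - (1 + t_L)`. -/
noncomputable def nonSimpleParryPolynomial (β : ℝ) : ℤ[X] :=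
  (X ^ (preperiodLength β + periodLength β) -
      ∑ j ∈ Finset.Icc 1 (preperiodLength β + periodLength β),
        C (renyiDigit β j) * X ^ (preperiodLength β + periodLength β - j)) -
    (X ^ preperiodLength β -
      ∑ j ∈ Finset.Icc 1 (preperiodLength β),
        C (renyiDigit β j) * X ^ (preperiodLength β - j))

open Classical in
/-- The Parry polynomial `n*_β` of a Parry number `β`. -/
noncomputable def parryPolynomial (β : ℝ) : ℤ[X] :=
  if HasFiniteExpansion β then simpleParryPolynomial β else nonSimpleParryPolynomial β

/-- `R` is reciprocal: `R = R*`, where `R*(X) = X^{deg R} R(1/X)`. -/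
def IsReciprocalPolynomial (R : ℤ[X]) : Prop := R = R.reverse

/-- The 2-norm `‖Q‖₂ = (∑ |α_j|²)^{1/2}` of `Q = ∑ α_j X^j`. -/
noncomputable def polynomialTwoNorm (Q : ℤ[X]) : ℝ :=
  Real.sqrt (∑ j ∈ Finset.range (Q.natDegree + 1), |(Q.coeff j : ℝ)| ^ 2)

open Classical in
/-- The multiset of non-reciprocal irreducible factors of `R` in `ℤ[X]`, repeated according to
multiplicity and normalized to have positive leading coefficient. -/
noncomputable def nonReciprocalFactors (R : ℤ[X]) : Multiset ℤ[X] :=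
  (UniqueFactorizationMonoid.normalizedFactors R).filter (fun q => ¬ IsReciprocalPolynomial q)

/-- Pisot numbers: real algebraic integers `θ > 1` all of whose other Galois conjugates have
modulus less than `1`. -/
def IsPisotNumber (θ : ℝ) : Prop :=
  1 < θ ∧ IsIntegral ℤ θ ∧
    ∀ z : ℂ, aeval z (minpoly ℤ θ) = 0 → z ≠ (θ : ℂ) → ‖z‖ < 1

open Classical in
/-- The digit sum of the lacunarity condition, with `t₀ = -1`:
`∑_{j=0}^{m} t_j²` if `d_β(1)` is finite of length `m`, and
`∑_{j=0}^{L-1} t_j² + (1 + t_L)² + ∑_{j=1}^{m} (t_j - t_{L+j})²`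
if `d_β(1)` is not finite and has preperiod length `m` and period length `L`. -/
noncomputable def renyiDigitSum (β : ℝ) : ℤ :=
  if HasFiniteExpansion β then
    ∑ j ∈ Finset.range (expansionLength β + 1), renyiDigit β j ^ 2
  else
    ∑ j ∈ Finset.range (periodLength β), renyiDigit β j ^ 2 +
      (1 + renyiDigit β (periodLength β)) ^ 2 +
      ∑ j ∈ Finset.Icc 1 (preperiodLength β),
        (renyiDigit β j - renyiDigit β (periodLength β + j)) ^ 2

/-!
The number of non-reciprocal factors is controlled by the Mahler measure `M`, the product of the
moduli of the roots outside the unit disc. It is multiplicative and at least `1` on monic integer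
polynomials. By Smyth's theorem (`one_add_mahlerMeasure_le_cube`) it satisfies `M³ ≥ M + 1`, that
is `M ≥ θ₀`, on a monic integer polynomial that does not vanish at `0` and is not its own reverse
up to sign; and by a strict form of Landau's inequality (`mahlerMeasure_sq_lt_sum_norm_sq`) it is
smaller than the `2`-norm. For the Parry polynomial `n` with `N` non-reciprocal irreducible factors
this gives `θ₀ ^ N ≤ M(n) < ‖n‖₂`. The factors `X` and `X - 1`, which are not their own reverses
but have Mahler measure `1`, do not occur, since `n(0)` and `n(1)` do not vanish. As `‖n‖₂²` is the
digit sum in the lacunarity condition, that condition forces `N < 2`. A Pisot number is the Mahler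
measure of its minimal polynomial, so Smyth's theorem also shows that `θ₀` is the smallest one.

Smyth's theorem is proved by formal power series. If `p` is monic with `p(0) = e = ±1`, the
Blaschke products attached to the roots inside and outside the disc give power series `f` and `g`
with `e p / p* = f / g` and `|g(0)| = 1 / M`; the quotient on the left has integer coefficients and
constant term `1`. The only analytic input, that Blaschke products are bounded by `1` on the disc,
is replaced by the statement that multiplication by them does not increase the `ℓ²` norm of initial
segments (`IsContractive`), which for a single factor is a telescoping identity. Hence all finite
Toeplitz matrices of `f` and `g` are contractions. With the quotient equal to
`1 + a X^k + ⋯`, testing these matrices on a few vectors supported on multiples of `k`, or on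
`{0, r, k, k + r}` when `X^(k + r)` with `0 < r < k` is the next power that occurs, gives
`c³ + c² ≤ 1` for `c = 1 / M` (`cube_add_sq_le_one_of_integer_quotient`).
-/

/-! ### Contractive power series -/

/-- A formal power series `f` is contractive if multiplication by `f` does not increase the
`ℓ²` norm of any initial segment of coefficients. This is the formal counterpart of being
analytic on the unit disc and bounded there by `1`. -/
def IsContractive {𝕜 : Type*} [RCLike 𝕜] (f : PowerSeries 𝕜) : Prop :=
  ∀ (v : PowerSeries 𝕜) (N : ℕ),
    ∑ i ∈ Finset.range N, ‖PowerSeries.coeff i (f * v)‖ ^ 2 ≤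
      ∑ i ∈ Finset.range N, ‖PowerSeries.coeff i v‖ ^ 2

namespace IsContractive

variable {𝕜 : Type*} [RCLike 𝕜]

lemma one : IsContractive (1 : PowerSeries 𝕜) := fun v N => by simp

lemma mul {f g : PowerSeries 𝕜} (hf : IsContractive f) (hg : IsContractive g) :
    IsContractive (f * g) := fun v N => by
  rw [mul_assoc]
  exact (hf _ _).trans (hg _ _)

lemma C_of_norm_le_one {u : 𝕜} (hu : ‖u‖ ≤ 1) : IsContractive (PowerSeries.C u) := fun v N => by
  refine Finset.sum_le_sum fun i _ => ?_
  rw [PowerSeries.coeff_C_mul, norm_mul]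
  gcongr
  exact mul_le_of_le_one_left (norm_nonneg _) hu

/-- A finite section of the contraction property: the Toeplitz matrix built on finitely many
indices `s j` is a contraction. -/
lemma sum_sq_toeplitz_le {m : ℕ} {f : PowerSeries ℝ} (hf : IsContractive f) {s : Fin m → ℕ}
    (hs : Function.Injective s) (y : Fin m → ℝ) :
    ∑ j, (∑ l, if s l ≤ s j then y l * PowerSeries.coeff (s j - s l) f else 0) ^ 2 ≤
      ∑ j, y j ^ 2 := by
  set N := (Finset.univ.sup s) + 1
  have hN : ∀ j, s j < N := fun j =>
    Nat.lt_succ_of_le (Finset.le_sup (f := s) (Finset.mem_univ j))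
  set v : PowerSeries ℝ := ∑ l, PowerSeries.C (y l) * PowerSeries.X ^ (s l)
  have hv : ∀ n, PowerSeries.coeff n v = ∑ l, if n = s l then y l else 0 := by
    intro n
    simp [v, PowerSeries.coeff_C_mul, PowerSeries.coeff_X_pow]
  have hfv : ∀ n, PowerSeries.coeff n (f * v) =
      ∑ l, if s l ≤ n then y l * PowerSeries.coeff (n - s l) f else 0 := by
    intro n
    simp only [v, Finset.mul_sum, map_sum]
    refine Finset.sum_congr rfl fun l _ => ?_
    rw [mul_left_comm, PowerSeries.coeff_C_mul, PowerSeries.coeff_mul_X_pow', mul_ite, mul_zero]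
  have himg : Finset.univ.image s ⊆ Finset.range N := by
    intro n hn
    obtain ⟨j, -, rfl⟩ := Finset.mem_image.1 hn
    exact Finset.mem_range.2 (hN j)
  have key := hf v N
  have h1 : ∑ j, (PowerSeries.coeff (s j) (f * v)) ^ 2 ≤
      ∑ i ∈ Finset.range N, ‖PowerSeries.coeff i (f * v)‖ ^ 2 := by
    rw [← Finset.sum_image (f := fun n => (PowerSeries.coeff n (f * v)) ^ 2)
      (hs.injOn)]
    simp only [Real.norm_eq_abs, sq_abs]
    exact Finset.sum_le_sum_of_subset_of_nonneg himg fun _ _ _ => sq_nonneg _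
  have h2 : ∑ i ∈ Finset.range N, ‖PowerSeries.coeff i v‖ ^ 2 = ∑ j, y j ^ 2 := by
    have h3 : ∀ j, PowerSeries.coeff (s j) v = y j := by
      intro j
      rw [hv]
      simp [hs.eq_iff]
    have h4 : ∑ j, y j ^ 2 = ∑ j, (PowerSeries.coeff (s j) v) ^ 2 := by simp [h3]
    rw [h4, ← Finset.sum_image (f := fun n => (PowerSeries.coeff n v) ^ 2) (hs.injOn)]
    simp only [Real.norm_eq_abs, sq_abs]
    refine (Finset.sum_subset himg fun n _ hn => ?_).symm
    rw [hv, Finset.sum_eq_zero, zero_pow two_ne_zero]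
    intro l _
    rw [if_neg]
    rintro rfl
    exact hn (Finset.mem_image_of_mem s (Finset.mem_univ l))
  calc _ = ∑ j, (PowerSeries.coeff (s j) (f * v)) ^ 2 := by simp [hfv]
    _ ≤ _ := h1.trans (key.trans h2.le)

end IsContractive

/-! ### Blaschke factors -/

/-- Telescoping form of the identity `|z - α| = |1 - ᾱ z|` on the unit circle. -/
lemma sum_norm_sq_blaschke (α : ℂ) (h : PowerSeries ℂ) (N : ℕ) :
    ∑ i ∈ Finset.range (N + 1),
        ‖PowerSeries.coeff i ((1 - PowerSeries.C (starRingEnd ℂ α) * PowerSeries.X) * h)‖ ^ 2 =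
      ∑ i ∈ Finset.range (N + 1),
        ‖PowerSeries.coeff i ((PowerSeries.X - PowerSeries.C α) * h)‖ ^ 2 +
      (1 - ‖α‖ ^ 2) * ‖PowerSeries.coeff N h‖ ^ 2 := by
  induction N with
  | zero =>
    simp [sub_mul, mul_assoc]
    ring
  | succ N ih =>
    rw [Finset.sum_range_succ, ih, Finset.sum_range_succ _ (N + 1)]
    simp only [sub_mul, mul_assoc, one_mul, map_sub, PowerSeries.coeff_C_mul,
      PowerSeries.coeff_succ_X_mul]
    generalize PowerSeries.coeff N h = a
    generalize PowerSeries.coeff (N + 1) h = b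
    simp only [← Complex.normSq_eq_norm_sq, Complex.normSq_apply, Complex.sub_re, Complex.sub_im,
      Complex.mul_re, Complex.mul_im, Complex.conj_re, Complex.conj_im]
    ring

lemma sum_norm_sq_X_sub_C_mul_le {α : ℂ} (hα : ‖α‖ ≤ 1) (h : PowerSeries ℂ) (N : ℕ) :
    ∑ i ∈ Finset.range N, ‖PowerSeries.coeff i ((PowerSeries.X - PowerSeries.C α) * h)‖ ^ 2 ≤
    ∑ i ∈ Finset.range N,
      ‖PowerSeries.coeff i ((1 - PowerSeries.C (starRingEnd ℂ α) * PowerSeries.X) * h)‖ ^ 2 := by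
  cases N with
  | zero => simp
  | succ N =>
    rw [sum_norm_sq_blaschke]
    have : 0 ≤ 1 - ‖α‖ ^ 2 := by nlinarith [norm_nonneg α]
    have := mul_nonneg this (sq_nonneg ‖PowerSeries.coeff N h‖)
    linarith

lemma sum_norm_sq_one_sub_mul_le {α : ℂ} (hα : 1 ≤ ‖α‖) (h : PowerSeries ℂ) (N : ℕ) :
    ∑ i ∈ Finset.range N,
      ‖PowerSeries.coeff i ((1 - PowerSeries.C (starRingEnd ℂ α) * PowerSeries.X) * h)‖ ^ 2 ≤
    ∑ i ∈ Finset.range N,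
      ‖PowerSeries.coeff i ((PowerSeries.X - PowerSeries.C α) * h)‖ ^ 2 := by
  cases N with
  | zero => simp
  | succ N =>
    rw [sum_norm_sq_blaschke]
    have : 0 ≤ ‖α‖ ^ 2 - 1 := by nlinarith
    have := mul_nonneg this (sq_nonneg ‖PowerSeries.coeff N h‖)
    linarith

/-- `∏ (X - α)` over a multiset of complex numbers. -/
noncomputable def rootProd (S : Multiset ℂ) : ℂ[X] := (S.map fun α => X - C α).prod

/-- `∏ (1 - ᾱ X)` over a multiset of complex numbers. -/
noncomputable def conjRevProd (S : Multiset ℂ) : ℂ[X] :=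
  (S.map fun α => 1 - C (starRingEnd ℂ α) * X).prod

lemma exists_contractive_of_contraction {a b : PowerSeries ℂ}
    (ha : PowerSeries.constantCoeff a ≠ 0)
    (hab : ∀ (h : PowerSeries ℂ) (N : ℕ),
      ∑ i ∈ Finset.range N, ‖PowerSeries.coeff i (b * h)‖ ^ 2 ≤
        ∑ i ∈ Finset.range N, ‖PowerSeries.coeff i (a * h)‖ ^ 2) :
    ∃ f : PowerSeries ℂ, IsContractive f ∧ f * a = b := by
  refine ⟨b * a⁻¹, fun v N => ?_, ?_⟩
  · have := hab (a⁻¹ * v) N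
    rwa [← mul_assoc, ← mul_assoc, PowerSeries.mul_inv_cancel _ ha, one_mul] at this
  · rw [mul_assoc, PowerSeries.inv_mul_cancel _ ha, mul_one]

/-- The Blaschke product of the roots in the closed unit disc. -/
lemma exists_contractive_mul_conjRevProd (S : Multiset ℂ) (hS : ∀ α ∈ S, ‖α‖ ≤ 1) :
    ∃ f : PowerSeries ℂ, IsContractive f ∧
      f * (conjRevProd S : PowerSeries ℂ) = (rootProd S : PowerSeries ℂ) := by
  induction S using Multiset.induction_on with
  | empty => exact ⟨1, .one, by simp [conjRevProd, rootProd]⟩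
  | cons α S ih =>
    obtain ⟨f, hf, hfS⟩ := ih fun a ha => hS a (Multiset.mem_cons_of_mem ha)
    obtain ⟨b, hb, hbα⟩ := exists_contractive_of_contraction
      (a := 1 - PowerSeries.C (starRingEnd ℂ α) * PowerSeries.X)
      (b := PowerSeries.X - PowerSeries.C α) (by simp)
      (sum_norm_sq_X_sub_C_mul_le (hS α (Multiset.mem_cons_self _ _)))
    refine ⟨b * f, hb.mul hf, ?_⟩
    simp only [conjRevProd, rootProd, Multiset.map_cons, Multiset.prod_cons, coe_mul] at hfS ⊢
    rw [mul_mul_mul_comm, hfS]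
    congr 1
    simpa using hbα

/-- The reciprocal of the Blaschke product of the roots outside the unit disc. -/
lemma exists_contractive_mul_rootProd (S : Multiset ℂ) (hS : ∀ α ∈ S, 1 < ‖α‖) :
    ∃ g : PowerSeries ℂ, IsContractive g ∧
      g * (rootProd S : PowerSeries ℂ) = (conjRevProd S : PowerSeries ℂ) := by
  induction S using Multiset.induction_on with
  | empty => exact ⟨1, .one, by simp [conjRevProd, rootProd]⟩
  | cons α S ih =>
    obtain ⟨g, hg, hgS⟩ := ih fun a ha => hS a (Multiset.mem_cons_of_mem ha)
    have hα := hS α (Multiset.mem_cons_self _ _)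
    obtain ⟨b, hb, hbα⟩ := exists_contractive_of_contraction
      (a := PowerSeries.X - PowerSeries.C α)
      (b := 1 - PowerSeries.C (starRingEnd ℂ α) * PowerSeries.X)
      (by
        simp only [map_sub, PowerSeries.constantCoeff_X, PowerSeries.constantCoeff_C, zero_sub,
          neg_ne_zero]
        exact norm_pos_iff.1 (one_pos.trans hα))
      (sum_norm_sq_one_sub_mul_le hα.le)
    refine ⟨b * g, hb.mul hg, ?_⟩
    simp only [conjRevProd, rootProd, Multiset.map_cons, Multiset.prod_cons, coe_mul] at hgS ⊢
    rw [mul_mul_mul_comm, hgS]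
    congr 1
    simpa using hbα

/-! ### Coefficientwise real part -/

/-- The coefficientwise real part of a complex power series. -/
noncomputable def rePart (f : PowerSeries ℂ) : PowerSeries ℝ :=
  PowerSeries.mk fun n => (PowerSeries.coeff n f).re

@[simp] lemma coeff_rePart (f : PowerSeries ℂ) (n : ℕ) :
    PowerSeries.coeff n (rePart f) = (PowerSeries.coeff n f).re := PowerSeries.coeff_mk _ _

lemma rePart_map_mul (q : PowerSeries ℝ) (f : PowerSeries ℂ) :
    rePart (PowerSeries.map Complex.ofRealHom q * f) = q * rePart f := by
  ext n
  simp [PowerSeries.coeff_mul]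

lemma IsContractive.rePart {f : PowerSeries ℂ} (hf : IsContractive f) :
    IsContractive (rePart f) := fun v N => by
  have key := hf (PowerSeries.map Complex.ofRealHom v) N
  rw [mul_comm f] at key
  rw [mul_comm, ← rePart_map_mul]
  calc _ ≤ _ := Finset.sum_le_sum fun i _ => by
        rw [coeff_rePart]
        gcongr
        exact Complex.abs_re_le_norm _
    _ ≤ _ := key
    _ = _ := by simp

/-! ### Coefficient inequalities for contractive series -/

namespace IsContractive

variable {f : PowerSeries ℝ}

lemma neg_series (hf : IsContractive f) : IsContractive (-f) := fun v N => by
  simpa using hf v N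

/-- The quadratic form of the `2 × 2` Hankel matrix `[[c_k, c₀], [c₀, 0]]` is at most `1`. -/
lemma coeff_le_one_sub_sq (hf : IsContractive f) {k : ℕ} (hk : 0 < k) :
    PowerSeries.coeff k f ≤ 1 - PowerSeries.coeff 0 f ^ 2 := by
  have h := hf.sum_sq_toeplitz_le (s := ![0, k])
    (by intro i j; fin_cases i <;> fin_cases j <;> simp <;> omega)
    ![1, PowerSeries.coeff 0 f]
  simp only [Fin.sum_univ_two, Matrix.cons_val_zero, Matrix.cons_val_one, le_refl, if_true,
    Nat.not_le.2 hk, if_false, Nat.zero_le, tsub_zero, tsub_self] at h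
  nlinarith [sq_nonneg (PowerSeries.coeff k f + PowerSeries.coeff 0 f * PowerSeries.coeff 0 f - 1)]

lemma abs_coeff_le_one_sub_sq (hf : IsContractive f) {k : ℕ} (hk : 0 < k) :
    |PowerSeries.coeff k f| ≤ 1 - PowerSeries.coeff 0 f ^ 2 := by
  have h1 := hf.coeff_le_one_sub_sq hk
  have h2 := hf.neg_series.coeff_le_one_sub_sq hk
  simp only [map_neg, even_two, Even.neg_pow] at h2
  exact abs_le.2 ⟨by linarith, h1⟩

/-- The quadratic form of the `3 × 3` Hankel matrix of `c_{2k}, c_k, c₀` is at most `1`; the test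
vector is the one that optimizes the resulting bound on `c_{2k}`. -/
lemma coeff_two_mul_le (hf : IsContractive f) {k : ℕ} (hk : 0 < k)
    (hc : PowerSeries.coeff 0 f < 1) :
    PowerSeries.coeff (2 * k) f ≤
      1 - PowerSeries.coeff 0 f ^ 2 -
        PowerSeries.coeff k f ^ 2 / (1 - PowerSeries.coeff 0 f) := by
  set c := PowerSeries.coeff 0 f with hcdef
  set α := PowerSeries.coeff k f with hα
  set γ := PowerSeries.coeff (2 * k) f with hγ
  have hc' : 0 < 1 - c := by linarith
  set y := α / (1 - c) with hy
  have hyα : α = y * (1 - c) := by rw [hy]; field_simp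
  have h := hf.sum_sq_toeplitz_le (s := ![0, k, 2 * k])
    (by intro i j; fin_cases i <;> fin_cases j <;> simp <;> omega)
    ![1, y, c]
  simp [Fin.sum_univ_three, hk.ne', show ¬ 2 * k ≤ k by omega,
    show k ≤ 2 * k by omega, show 2 * k - k = k by omega] at h
  rw [← PowerSeries.coeff_zero_eq_constantCoeff_apply, ← hcdef, ← hα, ← hγ] at h
  have h2 : α ^ 2 / (1 - c) = y ^ 2 * (1 - c) := by
    rw [hyα]; field_simp
  rw [h2]
  rw [hyα] at h
  nlinarith [sq_nonneg (γ + y * (y * (1 - c)) + c * c - 1)]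

end IsContractive

/-! ### The extremal problem -/

/-- The optimization behind the constant `θ₀`: the bound is attained at `b = -(1 - c²)`. -/
lemma cube_add_sq_le_one {b c : ℝ} (hc0 : 0 < c) (hc1 : c < 1) (hb : -(1 - c ^ 2) ≤ b)
    (h : c + b ≤ 2 * (1 - c ^ 2) - (c + b) ^ 2 / (1 - c) - b ^ 2 / (1 + c)) :
    c ^ 3 + c ^ 2 ≤ 1 := by
  by_contra! hlt
  have hc6 : 3 / 5 < c := by
    by_contra! h6
    nlinarith [mul_nonneg hc0.le hc0.le, mul_nonneg (mul_nonneg hc0.le hc0.le) hc0.le]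
  have h1 : 0 < 1 - c := by linarith
  have h2 : 0 < 1 + c := by linarith
  have e1 : (c + b) ^ 2 / (1 - c) * (1 - c) = (c + b) ^ 2 := by field_simp
  have e2 : b ^ 2 / (1 + c) * (1 + c) = b ^ 2 := by field_simp
  obtain ⟨w, hw, rfl⟩ : ∃ w, 0 ≤ w ∧ b = -(1 - c ^ 2) + w := ⟨b + (1 - c ^ 2), by linarith, by ring⟩
  have h3 : (c + (-(1 - c ^ 2) + w)) * ((1 - c) * (1 + c)) ≤
      2 * (1 - c ^ 2) * ((1 - c) * (1 + c)) - (c + (-(1 - c ^ 2) + w)) ^ 2 * (1 + c) -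
        (-(1 - c ^ 2) + w) ^ 2 * (1 - c) := by
    linear_combination (mul_le_mul_of_nonneg_right h (mul_pos h1 h2).le) - (1 + c) * e1 -
      (1 - c) * e2
  have h4 : 0 ≤ (1 + c) * ((1 - c ^ 2 - c ^ 3) + w * (3 - 5 * c)) - 2 * w ^ 2 := by
    nlinarith
  have h5 : (1 + c) * ((1 - c ^ 2 - c ^ 3) + w * (3 - 5 * c)) < 0 := by
    apply mul_neg_of_pos_of_neg h2
    nlinarith
  nlinarith [sq_nonneg w]

/-- The case of a quotient `1 + X^k + n X^{2k} + ⋯` with no exponent strictly between `k` and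
`2k`. -/
lemma cube_add_sq_le_one_of_two_mul {f g : PowerSeries ℝ} (hf : IsContractive f)
    (hg : IsContractive g) {k : ℕ} (hk : 0 < k) {c : ℝ} (hc : 0 < c) (n : ℤ)
    (hf0 : PowerSeries.coeff 0 f = c) (hg0 : PowerSeries.coeff 0 g = c)
    (h1 : PowerSeries.coeff k f = PowerSeries.coeff k g + c)
    (h2 : PowerSeries.coeff (2 * k) f =
      PowerSeries.coeff (2 * k) g + n * c + PowerSeries.coeff k g) :
    c ^ 3 + c ^ 2 ≤ 1 := by
  have bf := abs_le.1 (hf.abs_coeff_le_one_sub_sq hk)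
  have bg := abs_le.1 (hg.abs_coeff_le_one_sub_sq hk)
  rw [hf0] at bf
  rw [hg0] at bg
  have hc1 : c < 1 := by nlinarith
  have uf := hf.coeff_two_mul_le hk (by linarith)
  have ug := hg.coeff_two_mul_le hk (by linarith)
  have lf := hf.neg_series.coeff_two_mul_le hk (by simp only [map_neg]; linarith)
  have lg := hg.neg_series.coeff_two_mul_le hk (by simp only [map_neg]; linarith)
  simp only [map_neg, hf0, hg0, even_two, Even.neg_pow, sub_neg_eq_add] at uf ug lf lg
  rcases le_or_gt 1 n with hn | hn
  · have hn' : (1 : ℝ) ≤ n := by exact_mod_cast hn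
    refine cube_add_sq_le_one (b := PowerSeries.coeff k g) hc hc1 (by linarith) ?_
    rw [h1, add_comm (PowerSeries.coeff k g)] at uf
    nlinarith
  · -- The substitution `X ↦ -X` in the inverse quotient exchanges `n` and `1 - n`.
    have hn' : (n : ℝ) ≤ 0 := by exact_mod_cast Int.lt_add_one_iff.1 (by simpa using hn)
    refine cube_add_sq_le_one (b := - PowerSeries.coeff k f) hc hc1 (by linarith) ?_
    rw [show PowerSeries.coeff k g = -(c + - PowerSeries.coeff k f) by linarith] at ug h2
    rw [show PowerSeries.coeff k f ^ 2 = (- PowerSeries.coeff k f) ^ 2 by ring] at lf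
    rw [neg_sq] at ug
    nlinarith

/-- The case of a quotient `1 + X^k + a X^{k+r} + ⋯` with `0 < r < k` and `a ≠ 0`. The two series
are tested against `5 + 13σ X^r ∓ 5 X^k ± 13σ X^{k+r}`, where `σ` is the sign of `a`; these
vectors nearly maximize the resulting lower bound. -/
lemma lt_of_lt_two_mul {f g : PowerSeries ℝ} (hf : IsContractive f)
    (hg : IsContractive g) {k r : ℕ} (hr : 0 < r) (hrk : r < k) {c : ℝ} (hc : 0 < c) {a : ℤ}
    (ha : a ≠ 0)
    (hf0 : PowerSeries.coeff 0 f = c) (hg0 : PowerSeries.coeff 0 g = c)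
    (hlow : ∀ i < k, PowerSeries.coeff i f = PowerSeries.coeff i g)
    (h1 : PowerSeries.coeff k f = PowerSeries.coeff k g + c)
    (h2 : PowerSeries.coeff (k + r) f =
      PowerSeries.coeff (k + r) g + a * c + PowerSeries.coeff r g) :
    c < 7548 / 10000 := by
  obtain ⟨σ, b, hσ, hab, hb⟩ : ∃ σ b : ℝ, σ ^ 2 = 1 ∧ (a : ℝ) = σ * b ∧ 1 ≤ b := by
    rcases lt_or_gt_of_ne ha with h | h
    · have : (a : ℝ) ≤ -1 := by exact_mod_cast Int.le_sub_one_of_lt h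
      exact ⟨-1, -a, by norm_num, by ring, by linarith⟩
    · have : (1 : ℝ) ≤ a := by exact_mod_cast h
      exact ⟨1, a, by norm_num, by ring, by linarith⟩
  have hs : Function.Injective ![0, r, k, k + r] := by
    intro i j; fin_cases i <;> fin_cases j <;> simp <;> omega
  have tf := hf.sum_sq_toeplitz_le hs ![5, 13 * σ, -5, 13 * σ]
  have tg := hg.sum_sq_toeplitz_le hs ![5, 13 * σ, 5, -(13 * σ)]
  simp [Fin.sum_univ_four, hr.ne', hrk.not_ge, (hr.trans hrk).ne', hrk.le] at tf tg
  simp only [← PowerSeries.coeff_zero_eq_constantCoeff_apply] at tf tg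
  have br := hg.abs_coeff_le_one_sub_sq hr
  rw [hf0, h1, h2, hlow r hrk, hlow (k - r) (by omega)] at tf
  rw [hg0] at tg br
  obtain ⟨x, hx⟩ : ∃ x, PowerSeries.coeff r g = σ * x :=
    ⟨σ * PowerSeries.coeff r g, by rw [← mul_assoc, ← sq, hσ, one_mul]⟩
  rw [hx, hab] at tf
  rw [hx] at tg br
  generalize PowerSeries.coeff k g = d at tf tg
  generalize PowerSeries.coeff (k - r) g = e at tf tg
  generalize PowerSeries.coeff (k + r) g = d' at tf tg
  by_contra! hlt
  have habs : |σ| = 1 := by rw [← Real.sqrt_sq_eq_abs, hσ, Real.sqrt_one]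
  have hx1 : |x| ≤ 1 - c ^ 2 := by
    rwa [abs_mul, habs, one_mul] at br
  have bx := abs_le.1 hx1
  have main : (125 / 2) * c ^ 2 + 2 * (5 * x + 13 * c) ^ 2 +
      1 / 2 * (5 * (b * c) + 39 * c - 5 * x) ^ 2 ≤ 776 := by
    have q1 := sq_nonneg (2 * (5 * d + 13 * σ * e) + 5 * c)
    have q2 := sq_nonneg (5 * (d' + σ * b * c + σ * x) + 13 * σ * (d + c) + -(5 * (σ * x)) +
      13 * σ * c + (5 * d' + 13 * σ * d + 5 * (σ * x) + -(13 * σ * c)))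
    have q3 : (5 * (σ * x) + 13 * σ * c) ^ 2 = (5 * x + 13 * c) ^ 2 := by
      linear_combination (5 * x + 13 * c) ^ 2 * hσ
    have q4 : (σ * (5 * (b * c) + 39 * c - 5 * x)) ^ 2 = (5 * (b * c) + 39 * c - 5 * x) ^ 2 := by
      linear_combination (5 * (b * c) + 39 * c - 5 * x) ^ 2 * hσ
    have q5 : (13 * σ) ^ 2 = 169 := by linear_combination 169 * hσ
    rw [q3, q5] at tf tg
    rw [← q4]
    linarith
  have hbc : c ≤ b * c := le_mul_of_one_le_left hc.le hb
  have h44 : (44 * c - 5 * x) ^ 2 ≤ (5 * (b * c) + 39 * c - 5 * x) ^ 2 :=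
    pow_le_pow_left₀ (by nlinarith) (by linarith) 2
  nlinarith [sq_nonneg (25 * x + 8 * c)]


/-- If `R` has no terms of exponent strictly between `0` and `r`, then only two products
contribute to the coefficient of `X^r` in `R * g`. -/
lemma coeff_mul_of_coeff_eq_zero {A : Type*} [CommRing A] {R g : PowerSeries A} {r : ℕ}
    (hr : 0 < r) (hR : ∀ i, 0 < i → i < r → PowerSeries.coeff i R = 0) :
    PowerSeries.coeff r (R * g) = PowerSeries.coeff 0 R * PowerSeries.coeff r g +
      PowerSeries.coeff r R * PowerSeries.coeff 0 g := by
  rw [PowerSeries.coeff_mul, Finset.Nat.sum_antidiagonal_eq_sum_range_succ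
    (fun i j => PowerSeries.coeff i R * PowerSeries.coeff j g)]
  obtain ⟨s, rfl⟩ := Nat.exists_eq_succ_of_ne_zero hr.ne'
  rw [Finset.sum_range_succ, Finset.sum_range_succ', Finset.sum_eq_zero, zero_add, Nat.sub_zero,
    Nat.sub_self]
  intro i hi
  rw [hR (i + 1) (Nat.succ_pos i) (by have := Finset.mem_range.1 hi; omega), zero_mul]

/-- If the quotient of two contractive real power series with positive constant term `c` is a
nonconstant power series with integer coefficients and constant term `1`, then
`c³ + c² ≤ 1`. -/
theorem cube_add_sq_le_one_of_integer_quotient {f g : PowerSeries ℝ} (hf : IsContractive f)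
    (hg : IsContractive g) {Q : PowerSeries ℤ} (hQ0 : PowerSeries.coeff 0 Q = 1) (hQ1 : Q ≠ 1)
    (hfg : f = PowerSeries.map (Int.castRingHom ℝ) Q * g) {c : ℝ} (hc : 0 < c)
    (hg0 : PowerSeries.coeff 0 g = c) : c ^ 3 + c ^ 2 ≤ 1 := by
  classical
  have hex : ∃ n, PowerSeries.coeff n (Q - 1) ≠ 0 := by
    by_contra! h
    exact hQ1 (sub_eq_zero.1 (PowerSeries.ext h))
  set k := Nat.find hex with hkdef
  have hkne : PowerSeries.coeff k (Q - 1) ≠ 0 := Nat.find_spec hex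
  have hk : 0 < k := by
    rcases Nat.eq_zero_or_pos k with h | h
    · rw [h] at hkne
      exact absurd (by rw [map_sub, hQ0]; simp) hkne
    · exact h
  obtain ⟨R, hR⟩ : (PowerSeries.X ^ k : PowerSeries ℤ) ∣ Q - 1 :=
    PowerSeries.X_pow_dvd_iff.2 fun m hm => not_not.1 (Nat.find_min hex hm)
  set R' : PowerSeries ℝ := PowerSeries.map (Int.castRingHom ℝ) R with hR'
  have hRc : ∀ i, PowerSeries.coeff i R' = PowerSeries.coeff i R := fun i => by simp [hR']
  have hfR : f = g + PowerSeries.X ^ k * (R' * g) := by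
    rw [hfg, ← sub_add_cancel Q 1, hR]
    simp only [map_add, map_mul, map_pow, PowerSeries.map_X, map_one, hR']
    ring
  have hlow : ∀ i < k, PowerSeries.coeff i f = PowerSeries.coeff i g := by
    intro i hi
    rw [hfR, map_add, PowerSeries.coeff_X_pow_mul', if_neg hi.not_ge, add_zero]
  have hhigh : ∀ i, PowerSeries.coeff (k + i) f =
      PowerSeries.coeff (k + i) g + PowerSeries.coeff i (R' * g) := by
    intro i
    conv_lhs => rw [hfR]
    rw [map_add, PowerSeries.coeff_X_pow_mul', if_pos (Nat.le_add_right k i),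
      Nat.add_sub_cancel_left]
  have hf0 : PowerSeries.coeff 0 f = c := by rw [hlow 0 hk, hg0]
  set a : ℤ := PowerSeries.coeff 0 R with ha
  have hane : a ≠ 0 := by
    rw [hR, PowerSeries.coeff_X_pow_mul', if_pos le_rfl, Nat.sub_self] at hkne
    exact hkne
  have hk1 : PowerSeries.coeff k f = PowerSeries.coeff k g + a * c := by
    have := hhigh 0
    rw [add_zero] at this
    rw [this, PowerSeries.coeff_mul, Finset.Nat.antidiagonal_zero, Finset.sum_singleton, hRc,
      hg0]
  have bf := abs_le.1 (hf.abs_coeff_le_one_sub_sq hk)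
  have bg := abs_le.1 (hg.abs_coeff_le_one_sub_sq hk)
  rw [hf0] at bf
  rw [hg0] at bg
  -- From `c < 7548 / 10000` the claim follows, since `7548 / 10000 < 1 / θ₀`.
  have hsmall : c < 7548 / 10000 → c ^ 3 + c ^ 2 ≤ 1 := fun h => by
    have h2 : c ^ 2 ≤ (7548 / 10000) ^ 2 := pow_le_pow_left₀ hc.le h.le 2
    have h3 : c ^ 3 ≤ (7548 / 10000) ^ 3 := pow_le_pow_left₀ hc.le h.le 3
    norm_num at h2 h3
    linarith
  by_cases ha2 : 2 ≤ |a|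
  · have ha2' : (2 : ℝ) ≤ |(a : ℝ)| := by exact_mod_cast ha2
    have h2c : 2 * c ≤ |(a : ℝ)| * c := mul_le_mul_of_nonneg_right ha2' hc.le
    rw [← abs_of_pos hc, ← abs_mul, abs_of_pos hc] at h2c
    have : |(a : ℝ) * c| ≤ 2 * (1 - c ^ 2) := abs_le.2 ⟨by linarith, by linarith⟩
    exact hsmall (by nlinarith)
  have ha1 : a = 1 ∨ a = -1 := by
    have := abs_pos.2 hane
    rcases abs_cases a with h | h <;> omega
  by_cases hr : ∃ r, (0 < r ∧ r < k) ∧ PowerSeries.coeff r R ≠ 0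
  · obtain ⟨⟨hr0, hrk⟩, hrne⟩ := Nat.find_spec hr
    set r := Nat.find hr
    have hmin : ∀ i, 0 < i → i < r → PowerSeries.coeff i R' = 0 := by
      intro i hi hir
      have := Nat.find_min hr hir
      rw [not_and, not_not] at this
      rw [hRc, this ⟨hi, hir.trans hrk⟩, Int.cast_zero]
    have hkr := hhigh r
    rw [coeff_mul_of_coeff_eq_zero hr0 hmin, hRc, hRc, ← ha, hg0] at hkr
    rcases ha1 with h | h
    · rw [h] at hkr hk1
      push_cast at hkr hk1
      exact hsmall (lt_of_lt_two_mul hf hg hr0 hrk hc hrne hf0 hg0 hlow (by linarith)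
        (by linarith))
    · rw [h] at hkr hk1
      push_cast at hkr hk1
      refine hsmall (lt_of_lt_two_mul hg hf hr0 hrk hc (neg_ne_zero.2 hrne) hg0 hf0
        (fun i hi => (hlow i hi).symm) (by linarith) ?_)
      rw [hlow r hrk]
      push_cast
      linarith
  · have hmin : ∀ i, 0 < i → i < k → PowerSeries.coeff i R' = 0 := by
      intro i hi hik
      rw [hRc]
      by_contra h
      exact hr ⟨i, ⟨hi, hik⟩, fun h0 => h (by rw [h0, Int.cast_zero])⟩
    have hkk := hhigh k
    rw [coeff_mul_of_coeff_eq_zero hk hmin, hRc, hRc, ← ha, hg0, ← two_mul] at hkk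
    rcases ha1 with h | h
    · rw [h] at hkk hk1
      push_cast at hkk hk1
      exact cube_add_sq_le_one_of_two_mul hf hg hk hc (PowerSeries.coeff k R) hf0 hg0
        (by linarith) (by linarith)
    · rw [h] at hkk hk1
      push_cast at hkk hk1
      refine cube_add_sq_le_one_of_two_mul hg hf hk hc (1 - PowerSeries.coeff k R) hg0 hf0
        (by linarith) ?_
      push_cast
      linarith

/-! ### Mahler measures: Smyth's theorem and a strict form of Landau's inequality -/

lemma rootProd_add (S T : Multiset ℂ) : rootProd (S + T) = rootProd S * rootProd T := by
  simp [rootProd]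

lemma conjRevProd_add (S T : Multiset ℂ) :
    conjRevProd (S + T) = conjRevProd S * conjRevProd T := by
  simp [conjRevProd]

lemma rootProd_roots {p : ℂ[X]} (hp : p.Monic) : rootProd p.roots = p :=
  prod_multiset_X_sub_C_of_monic_of_roots_card_eq hp (IsAlgClosed.card_roots_eq_natDegree)

lemma coeff_zero_conjRevProd (S : Multiset ℂ) : (conjRevProd S).coeff 0 = 1 := by
  rw [coeff_zero_eq_eval_zero, conjRevProd, eval_multiset_prod, Multiset.map_map]
  refine Multiset.prod_eq_one fun x hx => ?_
  obtain ⟨a, -, rfl⟩ := Multiset.mem_map.1 hx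
  simp

lemma norm_coeff_zero_rootProd (S : Multiset ℂ) :
    ‖(rootProd S).coeff 0‖ = (S.map norm).prod := by
  induction S using Multiset.induction_on with
  | empty => simp [rootProd]
  | cons a S ih =>
    rw [rootProd, Multiset.map_cons, Multiset.prod_cons, mul_coeff_zero, norm_mul, Multiset.map_cons,
      Multiset.prod_cons]
    congr 1
    simp

lemma conjRevProd_natDegree_leadingCoeff (S : Multiset ℂ) (hS : ∀ α ∈ S, α ≠ 0) :
    (conjRevProd S).natDegree = S.card ∧ ‖(conjRevProd S).leadingCoeff‖ = (S.map norm).prod := by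
  induction S using Multiset.induction_on with
  | empty => simp [conjRevProd]
  | cons a S ih =>
    obtain ⟨h1, h2⟩ := ih fun b hb => hS b (Multiset.mem_cons_of_mem hb)
    have ha : -(starRingEnd ℂ a) ≠ 0 := by simpa using hS a (Multiset.mem_cons_self a S)
    have hfac : (1 - C (starRingEnd ℂ a) * X : ℂ[X]) = C (-(starRingEnd ℂ a)) * X + C 1 := by
      simp only [C_neg, C_1]; ring
    have hcons : conjRevProd (a ::ₘ S) = (C (-(starRingEnd ℂ a)) * X + C 1) * conjRevProd S := by
      rw [← hfac, conjRevProd, Multiset.map_cons, Multiset.prod_cons]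
      rfl
    have hne : conjRevProd S ≠ 0 := fun h => by
      have := coeff_zero_conjRevProd S
      simp [h] at this
    have hne' : (C (-(starRingEnd ℂ a)) * X + C 1 : ℂ[X]) ≠ 0 := fun h => by
      have := congrArg natDegree h
      rw [natDegree_linear ha] at this
      simp at this
    constructor
    · rw [hcons, natDegree_mul hne' hne, natDegree_linear ha, h1, Multiset.card_cons, add_comm]
    · rw [hcons, leadingCoeff_mul, leadingCoeff_linear ha, norm_mul, h2, Multiset.map_cons,
        Multiset.prod_cons, norm_neg, RCLike.norm_conj]

/-- The roots of `p` outside the closed unit disc. -/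
noncomputable def outerRoots (p : ℂ[X]) : Multiset ℂ := p.roots.filter (1 < ‖·‖)

/-- The roots of `p` in the closed unit disc. -/
noncomputable def innerRoots (p : ℂ[X]) : Multiset ℂ := p.roots.filter (¬ 1 < ‖·‖)

lemma innerRoots_add_outerRoots (p : ℂ[X]) : innerRoots p + outerRoots p = p.roots := by
  rw [add_comm]
  exact Multiset.filter_add_not _ _

lemma one_lt_norm_of_mem_outerRoots {p : ℂ[X]} : ∀ α ∈ outerRoots p, 1 < ‖α‖ :=
  fun _ h => (Multiset.mem_filter.1 h).2

lemma norm_le_one_of_mem_innerRoots {p : ℂ[X]} : ∀ α ∈ innerRoots p, ‖α‖ ≤ 1 :=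
  fun _ h => not_lt.1 (Multiset.mem_filter.1 h).2

lemma mahlerMeasure_eq_prod_norm_outerRoots {p : ℂ[X]} (hp : p.Monic) :
    p.mahlerMeasure = ((outerRoots p).map norm).prod := by
  rw [mahlerMeasure_eq_leadingCoeff_mul_prod_roots, hp.leadingCoeff, norm_one, one_mul,
    ← innerRoots_add_outerRoots p, Multiset.map_add, Multiset.prod_add]
  have h1 : ((innerRoots p).map fun a => max 1 ‖a‖).prod = 1 := by
    refine Multiset.prod_eq_one fun x hx => ?_
    obtain ⟨a, ha, rfl⟩ := Multiset.mem_map.1 hx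
    exact max_eq_left (norm_le_one_of_mem_innerRoots a ha)
  rw [h1, one_mul]
  congr 1
  exact Multiset.map_congr rfl fun a ha => max_eq_right (one_lt_norm_of_mem_outerRoots a ha).le

/-- Landau's inequality, with strictness coming from the constant coefficient: reflecting the
roots outside the disc gives a polynomial of no larger `2`-norm, whose leading coefficient has
modulus the Mahler measure and whose constant coefficient does not vanish. -/
theorem mahlerMeasure_sq_lt_sum_norm_sq {p : ℂ[X]} (hp : p.Monic) (h0 : p.coeff 0 ≠ 0)
    (hdeg : 0 < p.natDegree) :
    p.mahlerMeasure ^ 2 < ∑ i ∈ Finset.range (p.natDegree + 1), ‖p.coeff i‖ ^ 2 := by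
  obtain ⟨g, hg, hgp⟩ := exists_contractive_mul_rootProd (outerRoots p)
    one_lt_norm_of_mem_outerRoots
  have hout : ∀ α ∈ outerRoots p, α ≠ 0 := fun α hα =>
    norm_pos_iff.1 (one_pos.trans (one_lt_norm_of_mem_outerRoots α hα))
  obtain ⟨hd, hl⟩ := conjRevProd_natDegree_leadingCoeff _ hout
  have hsplit : rootProd (innerRoots p) * rootProd (outerRoots p) = p := by
    rw [← rootProd_add, innerRoots_add_outerRoots, rootProd_roots hp]
  set A : ℂ[X] := rootProd (innerRoots p) * conjRevProd (outerRoots p) with hA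
  have hmonic : (rootProd (innerRoots p)).Monic := monic_multiset_prod_of_monic _ _
    fun a _ => monic_X_sub_C a
  have hdegin : (rootProd (innerRoots p)).natDegree = (innerRoots p).card :=
    natDegree_multiset_prod_X_sub_C_eq_card _
  have hcard : p.natDegree = (innerRoots p).card + (outerRoots p).card := by
    rw [← Multiset.card_add, innerRoots_add_outerRoots, IsAlgClosed.card_roots_eq_natDegree]
  have hAn : ‖A.coeff p.natDegree‖ = p.mahlerMeasure := by
    rw [hcard, ← hd, ← hdegin, hA, coeff_mul_degree_add_degree, hmonic.leadingCoeff, one_mul, hl,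
      mahlerMeasure_eq_prod_norm_outerRoots hp]
  have hA0 : A.coeff 0 ≠ 0 := by
    rw [hA, mul_coeff_zero, coeff_zero_conjRevProd, mul_one]
    intro h
    rw [← hsplit, mul_coeff_zero, h, zero_mul] at h0
    exact h0 rfl
  have hgA : g * (p : PowerSeries ℂ) = A := by
    conv_lhs => rw [← hsplit]
    rw [coe_mul, mul_left_comm, hgp, hA, coe_mul]
  have key := hg p (p.natDegree + 1)
  rw [hgA] at key
  simp only [coeff_coe] at key
  refine lt_of_lt_of_le ?_ key
  rw [Finset.sum_range_succ, hAn]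
  have : 0 < ∑ i ∈ Finset.range p.natDegree, ‖A.coeff i‖ ^ 2 :=
    Finset.sum_pos' (fun _ _ => sq_nonneg _)
      ⟨0, Finset.mem_range.2 hdeg, pow_pos (norm_pos_iff.2 hA0) 2⟩
  linarith

lemma reverse_rootProd (S : Multiset ℂ) :
    (rootProd S).reverse = (S.map fun α => 1 - C α * X).prod := by
  induction S using Multiset.induction_on with
  | empty => simpa [rootProd] using reverse_C (1 : ℂ)
  | cons a S ih =>
    simp only [rootProd, Multiset.map_cons, Multiset.prod_cons, reverse_mul_of_domain] at ih ⊢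
    rw [ih]
    congr 1
    have : (X - C a).reverse = 1 - C a * X := by
      ext n
      rw [coeff_reverse, natDegree_X_sub_C]
      rcases n with _ | _ | n
      · simp [revAt_le]
      · simp [revAt_le, coeff_one]
      · rw [revAt_eq_self_of_lt (by omega)]
        simp [coeff_X, coeff_one]
    exact this

lemma reverse_map_of_injective {A B : Type*} [Semiring A] [Semiring B] {φ : A →+* B}
    (hφ : Function.Injective φ) (p : A[X]) : (p.map φ).reverse = p.reverse.map φ := by
  ext n
  simp [coeff_reverse, natDegree_map_eq_of_injective hφ]

/-- As `p` is real, its reverse is also the product of the factors `1 - ᾱ X`. -/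
lemma map_reverse_eq_conjRevProd {p : ℤ[X]} (hp : p.Monic) :
    p.reverse.map (Int.castRingHom ℂ) = conjRevProd (p.map (Int.castRingHom ℂ)).roots := by
  have h1 : p.reverse.map (Int.castRingHom ℂ) =
      ((p.map (Int.castRingHom ℂ)).roots.map fun α => 1 - C α * X).prod := by
    rw [← reverse_rootProd, rootProd_roots (hp.map _),
      reverse_map_of_injective (RingHom.injective_int _)]
  have h2 := congrArg (Polynomial.map (starRingEnd ℂ)) h1
  rw [Polynomial.map_map, RingHom.ext_int ((starRingEnd ℂ).comp (Int.castRingHom ℂ))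
    (Int.castRingHom ℂ), Polynomial.map_multiset_prod, Multiset.map_map] at h2
  rw [h2, conjRevProd]
  simp

/-- Smyth's inequality for a monic integer polynomial with constant coefficient `±1`. -/
lemma mahlerMeasure_cube_of_isUnit {p : ℤ[X]} (hp : p.Monic) {e : ℤ} (he : p.coeff 0 = e)
    (he2 : e * e = 1) (hrev : C e * p ≠ p.reverse) :
    1 + (p.map (Int.castRingHom ℂ)).mahlerMeasure ≤
      (p.map (Int.castRingHom ℂ)).mahlerMeasure ^ 3 := by
  set P := p.map (Int.castRingHom ℂ) with hP
  have hPm : P.Monic := hp.map _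
  obtain ⟨g, hg, hgp⟩ := exists_contractive_mul_rootProd (outerRoots P)
    one_lt_norm_of_mem_outerRoots
  obtain ⟨f, hf, hfp⟩ := exists_contractive_mul_conjRevProd (innerRoots P)
    norm_le_one_of_mem_innerRoots
  have hsplit : rootProd (innerRoots P) * rootProd (outerRoots P) = P := by
    rw [← rootProd_add, innerRoots_add_outerRoots, rootProd_roots hPm]
  have hsplit' : conjRevProd (innerRoots P) * conjRevProd (outerRoots P) =
      p.reverse.map (Int.castRingHom ℂ) := by
    rw [← conjRevProd_add, innerRoots_add_outerRoots, map_reverse_eq_conjRevProd hp]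
  have hr0 : PowerSeries.constantCoeff (p.reverse : PowerSeries ℤ) = ((1 : ℤˣ) : ℤ) := by
    rw [constantCoeff_coe, coeff_zero_reverse, hp.leadingCoeff, Units.val_one]
  -- the integer power series `e p / p*`
  set Q : PowerSeries ℤ := ((C e * p : ℤ[X]) : PowerSeries ℤ) *
    PowerSeries.invOfUnit (p.reverse : PowerSeries ℤ) 1 with hQ
  have hQr : Q * (p.reverse : PowerSeries ℤ) = ((C e * p : ℤ[X]) : PowerSeries ℤ) := by
    rw [hQ, mul_assoc, mul_comm (PowerSeries.invOfUnit _ _), PowerSeries.mul_invOfUnit _ _ hr0,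
      mul_one]
  have hQ0 : PowerSeries.coeff 0 Q = 1 := by
    have := congrArg PowerSeries.constantCoeff hQr
    rw [map_mul, hr0, Units.val_one, mul_one, constantCoeff_coe, coeff_C_mul, he, he2] at this
    simpa using this
  have hQ1 : Q ≠ 1 := by
    intro h
    rw [h, one_mul] at hQr
    exact hrev (coe_injective _ hQr).symm
  set q : PowerSeries ℂ := PowerSeries.map (Int.castRingHom ℂ) Q with hq
  have hqP : q * (conjRevProd (innerRoots P) * conjRevProd (outerRoots P) : ℂ[X]) =
      PowerSeries.C (e : ℂ) * ((rootProd (innerRoots P) * rootProd (outerRoots P) : ℂ[X]) :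
        PowerSeries ℂ) := by
    have := congrArg (PowerSeries.map (Int.castRingHom ℂ)) hQr
    rw [map_mul, ← polynomial_map_coe, ← polynomial_map_coe, Polynomial.map_mul, map_C] at this
    rw [hsplit, hsplit', hq, this, coe_mul, coe_C]
    rfl
  have hne : ∀ S, ((conjRevProd S : ℂ[X]) : PowerSeries ℂ) ≠ 0 := fun S h => by
    have := congrArg PowerSeries.constantCoeff h
    rw [constantCoeff_coe, coeff_zero_conjRevProd, map_zero] at this
    exact one_ne_zero this
  have hroot : ((rootProd (outerRoots P) : ℂ[X]) : PowerSeries ℂ) ≠ 0 := fun h => by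
    rw [h, mul_zero] at hgp
    exact hne _ hgp.symm
  have hfg : PowerSeries.C (e : ℂ) * f = q * g := by
    refine mul_right_cancel₀ (mul_ne_zero (hne (innerRoots P)) hroot) ?_
    rw [coe_mul, coe_mul, ← hgp, ← hfp] at hqP
    linear_combination -hqP
  -- the constant coefficient of `g` is the inverse of the Mahler measure
  have hg0 : ‖PowerSeries.coeff 0 g‖ * P.mahlerMeasure = 1 := by
    have := congrArg PowerSeries.constantCoeff hgp
    rw [map_mul, constantCoeff_coe, constantCoeff_coe, coeff_zero_conjRevProd] at this
    rw [mahlerMeasure_eq_prod_norm_outerRoots hPm, ← norm_coeff_zero_rootProd, ← norm_mul,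
      PowerSeries.coeff_zero_eq_constantCoeff_apply, this, norm_one]
  have hM : 0 < P.mahlerMeasure := mahlerMeasure_pos_of_ne_zero hPm.ne_zero
  set c := ‖PowerSeries.coeff 0 g‖ with hc
  have hcpos : 0 < c := by
    by_contra! h
    nlinarith
  -- a rotation makes the constant coefficient of `g` real
  set u : ℂ := starRingEnd ℂ (PowerSeries.coeff 0 g) / c with hu
  have hunorm : ‖u‖ ≤ 1 := by
    rw [hu, norm_div, RCLike.norm_conj, Complex.norm_real, ← hc, Real.norm_of_nonneg hcpos.le,
      div_self hcpos.ne']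
  have hug : u * PowerSeries.coeff 0 g = (c : ℂ) := by
    rw [hu, div_mul_eq_mul_div, mul_comm, Complex.mul_conj, Complex.normSq_eq_norm_sq, ← hc,
      div_eq_iff (by exact_mod_cast hcpos.ne')]
    push_cast
    ring
  have henorm : ‖(e : ℂ)‖ ≤ 1 := by
    have : e = 1 ∨ e = -1 := Int.isUnit_iff.1 (IsUnit.of_mul_eq_one e he2)
    rcases this with h | h <;> simp [h]
  have key := cube_add_sq_le_one_of_integer_quotient
    (f := rePart (PowerSeries.C u * (PowerSeries.C (e : ℂ) * f)))
    (g := rePart (PowerSeries.C u * g))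
    ((IsContractive.C_of_norm_le_one hunorm).mul
      ((IsContractive.C_of_norm_le_one henorm).mul hf)).rePart
    ((IsContractive.C_of_norm_le_one hunorm).mul hg).rePart hQ0 hQ1
    (by
      rw [← rePart_map_mul, hfg, hq]
      congr 1
      rw [mul_left_comm]
      congr 1)
    hcpos (by rw [coeff_rePart, PowerSeries.coeff_C_mul, hug, Complex.ofReal_re])
  have : c ^ 3 * P.mahlerMeasure ^ 3 = 1 := by rw [← mul_pow, hg0, one_pow]
  have h2 : c ^ 2 * P.mahlerMeasure ^ 3 = P.mahlerMeasure := by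
    calc _ = (c * P.mahlerMeasure) ^ 2 * P.mahlerMeasure := by ring
      _ = _ := by rw [hg0, one_pow, one_mul]
  nlinarith [mul_le_mul_of_nonneg_right key (pow_pos hM 3).le]

lemma norm_coeff_zero_le_mahlerMeasure {p : ℂ[X]} (hp : p.Monic) :
    ‖p.coeff 0‖ ≤ p.mahlerMeasure := by
  conv_lhs => rw [← rootProd_roots hp]
  rw [norm_coeff_zero_rootProd, mahlerMeasure_eq_leadingCoeff_mul_prod_roots, hp.leadingCoeff,
    norm_one, one_mul]
  exact Multiset.prod_map_le_prod_map₀ _ _ (fun _ _ => norm_nonneg _) fun _ _ => le_max_right _ _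

/-- Smyth's theorem for monic polynomials: if `p(0) ≠ 0` and `p` does not agree with its reverse
up to the sign `p(0)`, then the Mahler measure `M` of `p` satisfies `M³ ≥ M + 1`. -/
theorem one_add_mahlerMeasure_le_cube {p : ℤ[X]} (hp : p.Monic) (h0 : p.coeff 0 ≠ 0)
    (hrev : C (p.coeff 0) * p ≠ p.reverse) :
    1 + (p.map (Int.castRingHom ℂ)).mahlerMeasure ≤
      (p.map (Int.castRingHom ℂ)).mahlerMeasure ^ 3 := by
  by_cases h2 : 2 ≤ |p.coeff 0|
  · have h := norm_coeff_zero_le_mahlerMeasure (hp.map (Int.castRingHom ℂ))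
    rw [coeff_map, eq_intCast, Complex.norm_intCast] at h
    have h2' : (2 : ℝ) ≤ |(p.coeff 0 : ℝ)| := by exact_mod_cast h2
    have hM := h2'.trans h
    set M := (p.map (Int.castRingHom ℂ)).mahlerMeasure
    nlinarith [mul_nonneg (sub_nonneg.2 hM) (sub_nonneg.2 hM), pow_pos (two_pos.trans_le hM) 2]
  · have hpos := abs_pos.2 h0
    refine mahlerMeasure_cube_of_isUnit hp rfl ?_ hrev
    rw [← abs_mul_abs_self, show |p.coeff 0| = 1 by omega, one_mul]

/-! ### Pisot numbers -/

lemma exists_root_cube_sub_self_sub_one :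
    ∃ θ : ℝ, θ ^ 3 - θ - 1 = 0 ∧ 1.3247 ≤ θ ∧ θ < 1.3248 := by
  have hcont : ContinuousOn (fun x : ℝ => x ^ 3 - x - 1) (Set.Icc 1.3247 1.3248) := by fun_prop
  obtain ⟨θ, ⟨h1, h2⟩, h3⟩ := intermediate_value_Icc (by norm_num) hcont
    (show (0 : ℝ) ∈ Set.Icc _ _ by constructor <;> norm_num)
  refine ⟨θ, h3, h1, lt_of_le_of_ne h2 ?_⟩
  rintro rfl
  norm_num at h3

/-- The two non-real roots of `X³ - X - 1` are conjugate, with product `θ² - 1 = 1 / θ`. -/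
lemma norm_lt_one_of_cube_sub_self_sub_one {θ : ℝ} (h : θ ^ 3 - θ - 1 = 0) (h1 : 1.3247 ≤ θ)
    (h2 : θ < 1.3248) {z : ℂ} (hz : z ^ 3 - z - 1 = 0) (hne : z ≠ θ) : ‖z‖ < 1 := by
  have hθ : (θ : ℂ) ^ 3 - θ - 1 = 0 := by exact_mod_cast h
  have hq : z ^ 2 + θ * z + (θ ^ 2 - 1) = 0 := by
    refine (mul_eq_zero.1 ?_).resolve_left (sub_ne_zero.2 hne)
    linear_combination hz - hθ
  have hre := congrArg Complex.re hq
  have him := congrArg Complex.im hq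
  simp [sq] at hre him
  have him' : z.im * (2 * z.re + θ) = 0 := by linarith
  have hθ2 : 4 / 3 < θ ^ 2 ∧ θ ^ 2 < 2 := by constructor <;> nlinarith
  have hn : ‖z‖ ^ 2 < 1 := by
    rw [← Complex.normSq_eq_norm_sq, Complex.normSq_apply]
    rcases mul_eq_zero.1 him' with h0 | h0
    · rw [h0] at hre
      nlinarith [sq_nonneg (z.re + θ / 2)]
    · nlinarith
  nlinarith [norm_nonneg z]

lemma aeval_minpoly_int_of_aeval {θ : ℝ} (hθ : IsIntegral ℤ θ) {p : ℤ[X]} (hp : aeval θ p = 0)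
    {z : ℂ} (hz : aeval z (minpoly ℤ θ) = 0) : aeval z p = 0 := by
  obtain ⟨r, rfl⟩ := minpoly.isIntegrallyClosed_dvd hθ hp
  rw [map_mul, hz, zero_mul]

lemma isPisotNumber_of_cube_sub_self_sub_one {θ : ℝ} (h : θ ^ 3 - θ - 1 = 0) (h1 : 1.3247 ≤ θ)
    (h2 : θ < 1.3248) : IsPisotNumber θ := by
  have hp : aeval θ (X ^ 3 - X - 1 : ℤ[X]) = 0 := by simpa using h
  have hint : IsIntegral ℤ θ := ⟨X ^ 3 - X - 1, by monicity!, hp⟩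
  refine ⟨by norm_num at h1; linarith, hint, fun z hz hne => ?_⟩
  have := aeval_minpoly_int_of_aeval hint hp hz
  exact norm_lt_one_of_cube_sub_self_sub_one h h1 h2 (by simpa using this) hne

/-- The complex roots of the minimal polynomial over `ℤ` of a real algebraic integer are
simple. -/
lemma nodup_roots_minpoly_int {θ : ℝ} (hθ : IsIntegral ℤ θ) :
    ((minpoly ℤ θ).map (Int.castRingHom ℂ)).roots.Nodup := by
  have hQ : IsIntegral ℚ θ := hθ.tower_top
  have h : (minpoly ℤ θ).map (Int.castRingHom ℂ) = (minpoly ℚ θ).map (algebraMap ℚ ℂ) := by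
    rw [minpoly.isIntegrallyClosed_eq_field_fractions' ℚ hθ, Polynomial.map_map]
    congr 1
  rw [h]
  exact nodup_roots ((minpoly.irreducible hQ).separable.map)

lemma mem_roots_minpoly_int {θ : ℝ} (hθ : IsIntegral ℤ θ) {z : ℂ} :
    z ∈ ((minpoly ℤ θ).map (Int.castRingHom ℂ)).roots ↔ aeval z (minpoly ℤ θ) = 0 := by
  rw [mem_roots ((minpoly.monic hθ).map _).ne_zero, IsRoot.def, eval_map, aeval_def]
  rfl

lemma aeval_ofReal_minpoly_int (θ : ℝ) : aeval (θ : ℂ) (minpoly ℤ θ) = 0 := by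
  rw [← Complex.coe_algebraMap, aeval_algebraMap_apply, minpoly.aeval, map_zero]

lemma IsPisotNumber.mahlerMeasure_eq {θ : ℝ} (h : IsPisotNumber θ) :
    ((minpoly ℤ θ).map (Int.castRingHom ℂ)).mahlerMeasure = θ := by
  obtain ⟨h1, hint, hconj⟩ := h
  have hmem := (mem_roots_minpoly_int hint).2 (aeval_ofReal_minpoly_int θ)
  obtain ⟨S, hS⟩ := Multiset.exists_cons_of_mem hmem
  have hnd := nodup_roots_minpoly_int hint
  rw [hS, Multiset.nodup_cons] at hnd
  rw [mahlerMeasure_eq_leadingCoeff_mul_prod_roots, ((minpoly.monic hint).map _).leadingCoeff, hS,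
    Multiset.map_cons, Multiset.prod_cons, norm_one, one_mul, Multiset.prod_eq_one, mul_one,
    Complex.norm_real, Real.norm_of_nonneg (by linarith), max_eq_right h1.le]
  intro x hx
  obtain ⟨z, hz, rfl⟩ := Multiset.mem_map.1 hx
  have hzr := (mem_roots_minpoly_int hint).1 (hS ▸ Multiset.mem_cons_of_mem hz)
  exact max_eq_left (hconj z hzr fun h => hnd.1 (h ▸ hz)).le

lemma minpoly_int_coeff_zero_ne_zero {θ : ℝ} (hθ : IsIntegral ℤ θ) (h0 : θ ≠ 0) :
    (minpoly ℤ θ).coeff 0 ≠ 0 := by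
  intro h
  have hQ : IsIntegral ℚ θ := hθ.tower_top
  refine minpoly.coeff_zero_ne_zero hQ h0 ?_
  rw [minpoly.isIntegrallyClosed_eq_field_fractions' ℚ hθ, coeff_map, h, map_zero]

lemma aeval_inv_eq_zero_of_C_mul_eq_reverse {q : ℤ[X]} {e : ℤ} (he : e ≠ 0)
    (hq : C e * q = q.reverse) {z : ℂ} (hz0 : z ≠ 0) (hz : aeval z q = 0) :
    aeval z⁻¹ q = 0 := by
  let := invertibleOfNonzero hz0
  have h := (eval₂_reverse_eq_zero_iff (algebraMap ℤ ℂ) z q).2 hz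
  rw [← hq, eval₂_mul, eval₂_C, invOf_eq_inv] at h
  exact (mul_eq_zero.1 h).resolve_left (by simpa using he)

/-- A Pisot number whose minimal polynomial is reciprocal up to sign has `θ⁻¹` as its only other
conjugate, so that `θ + θ⁻¹` is an integer. -/
lemma IsPisotNumber.three_mul_le {θ : ℝ} (h : IsPisotNumber θ) {e : ℤ} (he : e ≠ 0)
    (hq : C e * minpoly ℤ θ = (minpoly ℤ θ).reverse) : 3 * θ ≤ θ ^ 2 + 1 := by
  obtain ⟨h1, hint, hconj⟩ := h
  have hθ0 : (θ : ℂ) ≠ 0 := by exact_mod_cast (by linarith : θ ≠ 0)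
  have hθr := aeval_ofReal_minpoly_int θ
  have hinv := aeval_inv_eq_zero_of_C_mul_eq_reverse he hq hθ0 hθr
  have hne : (θ : ℂ)⁻¹ ≠ θ := by
    rw [← Complex.ofReal_inv]
    exact_mod_cast (inv_lt_one_of_one_lt₀ h1 |>.trans h1).ne
  have hroots : ((minpoly ℤ θ).map (Int.castRingHom ℂ)).roots = {(θ : ℂ), (θ : ℂ)⁻¹} := by
    refine (Multiset.Nodup.ext (nodup_roots_minpoly_int hint) (by simpa using hne.symm)).2
      fun z => ?_
    rw [mem_roots_minpoly_int hint]
    simp only [Multiset.insert_eq_cons, Multiset.mem_cons, Multiset.mem_singleton]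
    constructor
    · intro hz
      by_cases hzθ : z = θ
      · exact Or.inl hzθ
      · right
        have hlt := hconj z hz hzθ
        have hz0 : z ≠ 0 := by
          rintro rfl
          rw [← coeff_zero_eq_aeval_zero'] at hz
          have := minpoly_int_coeff_zero_ne_zero hint (by linarith : θ ≠ 0)
          simp [this] at hz
        have hzinv := aeval_inv_eq_zero_of_C_mul_eq_reverse he hq hz0 hz
        by_contra hc
        have := hconj z⁻¹ hzinv fun h => hc (by rw [← h, inv_inv])
        rw [norm_inv] at this
        have := one_lt_inv_iff₀.2 ⟨norm_pos_iff.2 hz0, hlt⟩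
        linarith
    · rintro (rfl | rfl)
      · exact hθr
      · exact hinv
  have hprod := rootProd_roots ((minpoly.monic hint).map (Int.castRingHom ℂ))
  rw [hroots] at hprod
  have hc1 := congrArg (fun p : ℂ[X] => p.coeff 1) hprod
  simp [rootProd, sub_mul, mul_sub, coeff_X, coeff_mul_C] at hc1
  set n := (minpoly ℤ θ).coeff 1
  have hsum : θ + θ⁻¹ = -(n : ℝ) := by
    have : ((θ + θ⁻¹ : ℝ) : ℂ) = ((-(n : ℝ) : ℝ) : ℂ) := by
      push_cast
      linear_combination -hc1
    exact_mod_cast this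
  have hθinv : θ * θ⁻¹ = 1 := mul_inv_cancel₀ (by linarith)
  have h2 : (2 : ℝ) < -(n : ℝ) := by
    rw [← hsum]
    have : 0 < θ⁻¹ := by positivity
    nlinarith [sq_nonneg (θ - θ⁻¹), inv_lt_one_of_one_lt₀ h1,
      mul_pos (sub_pos.2 h1) (sub_pos.2 (inv_lt_one_of_one_lt₀ h1))]
  have h3 : (3 : ℝ) ≤ -(n : ℝ) := by
    have : (2 : ℤ) < -n := by exact_mod_cast h2
    exact_mod_cast (by omega : (3 : ℤ) ≤ -n)
  nlinarith

/-- Siegel's lower bound for Pisot numbers. -/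
theorem IsPisotNumber.one_add_le_cube {θ : ℝ} (h : IsPisotNumber θ) : 1 + θ ≤ θ ^ 3 := by
  have h1 := h.1
  have h0 := minpoly_int_coeff_zero_ne_zero h.2.1 (by linarith : θ ≠ 0)
  by_cases hq : C ((minpoly ℤ θ).coeff 0) * minpoly ℤ θ = (minpoly ℤ θ).reverse
  · have h3 := h.three_mul_le h0 hq
    have h2 : 2 ≤ θ := by nlinarith
    nlinarith [mul_nonneg (sub_nonneg.2 h2) (sub_nonneg.2 h2), pow_pos (two_pos.trans_le h2) 2]
  · have := one_add_mahlerMeasure_le_cube (minpoly.monic h.2.1) h0 hq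
    rwa [h.mahlerMeasure_eq] at this

lemma le_of_one_add_le_cube {θ x : ℝ} (h : θ ^ 3 - θ - 1 = 0) (h1 : 1.3247 ≤ θ) (hx : 1 ≤ x)
    (hx3 : 1 + x ≤ x ^ 3) : θ ≤ x := by
  norm_num at h1
  by_contra! hlt
  have : (θ - x) * (θ ^ 2 + θ * x + x ^ 2 - 1) ≤ 0 := by nlinarith
  nlinarith [mul_pos (sub_pos.2 hlt) (show 0 < θ ^ 2 + θ * x + x ^ 2 - 1 by nlinarith)]

/-! ### Parry polynomials -/

/-- The polynomial `t₀ X^n + t₁ X^{n-1} + ⋯ + t_n`, with the convention `t₀ = -1`. -/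
noncomputable def digitPolynomial (β : ℝ) (n : ℕ) : ℤ[X] :=
  ∑ j ∈ Finset.range (n + 1), C (renyiDigit β j) * X ^ (n - j)

lemma sum_Icc_one_eq_sum_range {A : Type*} [AddCommMonoid A] (f : ℕ → A) (n : ℕ) :
    ∑ j ∈ Finset.Icc 1 n, f j = ∑ j ∈ Finset.range n, f (j + 1) := by
  induction n with
  | zero => simp
  | succ n ih => rw [Finset.sum_Icc_succ_top (by omega), ih, Finset.sum_range_succ]

lemma digitPolynomial_eq (β : ℝ) (n : ℕ) :
    X ^ n - ∑ j ∈ Finset.Icc 1 n, C (renyiDigit β j) * X ^ (n - j) = -digitPolynomial β n := by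
  rw [digitPolynomial, Finset.sum_range_succ', sum_Icc_one_eq_sum_range, Nat.sub_zero, renyiDigit,
    C_neg, C_1]
  ring

lemma coeff_digitPolynomial (β : ℝ) (n i : ℕ) :
    (digitPolynomial β n).coeff i = if i ≤ n then renyiDigit β (n - i) else 0 := by
  simp only [digitPolynomial, finsetSum_coeff, coeff_C_mul, coeff_X_pow, mul_ite, mul_one,
    mul_zero]
  split_ifs with h
  · rw [Finset.sum_eq_single (n - i)]
    · rw [if_pos (by omega)]
    · intro j hj hne
      rw [if_neg]
      have := Finset.mem_range.1 hj
      omega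
    · intro hn
      exact absurd (Finset.mem_range.2 (by omega)) hn
  · exact Finset.sum_eq_zero fun j _ => if_neg (by omega)

lemma digitPolynomial_succ (β : ℝ) (n : ℕ) :
    digitPolynomial β (n + 1) = X * digitPolynomial β n + C (renyiDigit β (n + 1)) := by
  rw [digitPolynomial, Finset.sum_range_succ, Nat.sub_self, pow_zero, mul_one, digitPolynomial,
    Finset.mul_sum]
  congr 1
  refine Finset.sum_congr rfl fun j hj => ?_
  rw [Nat.succ_sub (Nat.lt_succ_iff.1 (Finset.mem_range.1 hj)), pow_succ]
  ring

lemma beta_mul_iterate (β : ℝ) (n : ℕ) :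
    β * (betaTransformation β)^[n] 1 =
      renyiDigit β (n + 1) + (betaTransformation β)^[n + 1] 1 := by
  rw [Function.iterate_succ_apply', betaTransformation, renyiDigit, Int.floor_add_fract]

lemma aeval_digitPolynomial (β : ℝ) (n : ℕ) :
    aeval β (digitPolynomial β n) = -(betaTransformation β)^[n] 1 := by
  induction n with
  | zero => simp [digitPolynomial, renyiDigit]
  | succ n ih =>
    have h := beta_mul_iterate β n
    rw [digitPolynomial_succ, map_add, map_mul, aeval_X, ih, aeval_C, algebraMap_int_eq, eq_intCast]
    linear_combination -h

lemma eval_one_digitPolynomial (β : ℝ) (n : ℕ) :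
    (digitPolynomial β n).eval 1 = ∑ j ∈ Finset.range (n + 1), renyiDigit β j := by
  simp [digitPolynomial, eval_finsetSum]

lemma iterate_mem_Icc (β : ℝ) (n : ℕ) :
    0 ≤ (betaTransformation β)^[n] 1 ∧ (betaTransformation β)^[n] 1 ≤ 1 := by
  cases n with
  | zero => simp
  | succ n =>
    rw [Function.iterate_succ_apply', betaTransformation]
    exact ⟨Int.fract_nonneg _, (Int.fract_lt_one _).le⟩

lemma renyiDigit_succ_nonneg {β : ℝ} (hβ : 1 < β) (n : ℕ) : 0 ≤ renyiDigit β (n + 1) :=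
  Int.floor_nonneg.2 (mul_nonneg (by linarith) (iterate_mem_Icc β n).1)

lemma one_le_renyiDigit_one {β : ℝ} (hβ : 1 < β) : 1 ≤ renyiDigit β 1 := by
  rw [renyiDigit, Int.le_floor]
  simpa using hβ.le

/-- If the digit sequences from `n` and from `l` on agree, so do the iterates of `1` under the
`β`-transformation: their distance is multiplied by `β` at each step, yet stays bounded. -/
lemma iterate_eq_of_renyiDigit_eq {β : ℝ} (hβ : 1 < β) {n l : ℕ}
    (h : ∀ i > n, renyiDigit β (i + l) = renyiDigit β i) :
    (betaTransformation β)^[n + l] 1 = (betaTransformation β)^[n] 1 := by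
  have key : ∀ i, (betaTransformation β)^[n + i + l] 1 - (betaTransformation β)^[n + i] 1 =
      β ^ i * ((betaTransformation β)^[n + l] 1 - (betaTransformation β)^[n] 1) := by
    intro i
    induction i with
    | zero => simp
    | succ i ih =>
      have h1 := beta_mul_iterate β (n + i)
      have h2 := beta_mul_iterate β (n + i + l)
      have h3 := h (n + i + 1) (by omega)
      rw [show n + i + l + 1 = n + i + 1 + l by ring, h3] at h2
      rw [← add_assoc, pow_succ]
      linear_combination β * ih + h1 - h2
  by_contra hne
  have hpos := abs_pos.2 (sub_ne_zero.2 hne)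
  set d := (betaTransformation β)^[n + l] 1 - (betaTransformation β)^[n] 1
  obtain ⟨i, hi⟩ := pow_unbounded_of_one_lt (1 / |d|) hβ
  have h1 := congrArg abs (key i)
  rw [abs_mul, abs_of_pos (pow_pos (show 0 < β by linarith) i)] at h1
  have h2 := iterate_mem_Icc β (n + i + l)
  have h3 := iterate_mem_Icc β (n + i)
  have h4 : |(betaTransformation β)^[n + i + l] 1 - (betaTransformation β)^[n + i] 1| ≤ 1 :=
    abs_le.2 ⟨by linarith, by linarith⟩
  rw [div_lt_iff₀ hpos] at hi
  linarith

/-- If all digits after the `n`-th vanish, then so does the `n`-th iterate of `1`. -/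
lemma iterate_eq_zero_of_renyiDigit_eq_zero {β : ℝ} (hβ : 1 < β) {n : ℕ}
    (h : ∀ i > n, renyiDigit β i = 0) : (betaTransformation β)^[n] 1 = 0 := by
  have h1 := iterate_eq_of_renyiDigit_eq hβ (n := n) (l := 1) fun i hi => by
    rw [h i hi, h (i + 1) (by omega)]
  have h2 := beta_mul_iterate β n
  rw [h (n + 1) (by omega), h1, Int.cast_zero, zero_add] at h2
  have h3 : (β - 1) * (betaTransformation β)^[n] 1 = 0 := by linear_combination h2
  exact (mul_eq_zero.1 h3).resolve_left (by linarith)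

/-- The squared `2`-norm of a polynomial, as an integer. -/
noncomputable def coeffSqSum (p : ℤ[X]) : ℤ := ∑ i ∈ Finset.range (p.natDegree + 1), p.coeff i ^ 2

lemma polynomialTwoNorm_sq (p : ℤ[X]) : polynomialTwoNorm p ^ 2 = coeffSqSum p := by
  rw [polynomialTwoNorm, Real.sq_sqrt (Finset.sum_nonneg fun _ _ => sq_nonneg _), coeffSqSum]
  push_cast
  exact Finset.sum_congr rfl fun _ _ => sq_abs _

section Simple

variable {β : ℝ}

lemma parryPolynomial_eq_of_finite (hfin : HasFiniteExpansion β) :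
    parryPolynomial β = -digitPolynomial β (expansionLength β) := by
  rw [parryPolynomial, if_pos hfin, simpleParryPolynomial, digitPolynomial_eq]

lemma renyiDigit_eq_zero_of_expansionLength_lt (hfin : HasFiniteExpansion β) :
    ∀ i > expansionLength β, renyiDigit β i = 0 := Nat.sInf_mem hfin

lemma expansionLength_pos (hβ : 1 < β) (hfin : HasFiniteExpansion β) : 0 < expansionLength β := by
  by_contra! h
  have h1 := renyiDigit_eq_zero_of_expansionLength_lt hfin 1 (by omega)
  have h2 := one_le_renyiDigit_one hβ
  omega

lemma renyiDigit_expansionLength_ne_zero (hβ : 1 < β) (hfin : HasFiniteExpansion β) :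
    renyiDigit β (expansionLength β) ≠ 0 := by
  intro h
  have hpos := expansionLength_pos hβ hfin
  have hle : expansionLength β ≤ expansionLength β - 1 := by
    refine Nat.sInf_le fun i hi => ?_
    rcases eq_or_ne i (expansionLength β) with rfl | hne
    · exact h
    · exact renyiDigit_eq_zero_of_expansionLength_lt hfin i (by omega)
  omega

end Simple

section NonSimple

variable {β : ℝ}

lemma parryPolynomial_eq_of_not_finite (hfin : ¬ HasFiniteExpansion β) :
    parryPolynomial β = digitPolynomial β (preperiodLength β) -
      digitPolynomial β (preperiodLength β + periodLength β) := by
  rw [parryPolynomial, if_neg hfin, nonSimpleParryPolynomial, digitPolynomial_eq,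
    digitPolynomial_eq]
  ring

lemma periodLength_spec (hper : HasEventuallyPeriodicExpansion β) :
    1 ≤ periodLength β ∧
      ∀ i > preperiodLength β, renyiDigit β (i + periodLength β) = renyiDigit β i := by
  obtain ⟨L, hL⟩ : preperiodLength β ∈
      {m : ℕ | ∃ L ≥ 1, ∀ i > m, renyiDigit β (i + L) = renyiDigit β i} := Nat.sInf_mem hper
  exact Nat.sInf_mem (s := {L : ℕ | L ≥ 1 ∧
    ∀ i > preperiodLength β, renyiDigit β (i + L) = renyiDigit β i}) ⟨L, hL⟩

lemma renyiDigit_preperiodLength_ne (hβ : 1 < β) (hper : HasEventuallyPeriodicExpansion β) :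
    renyiDigit β (preperiodLength β) ≠ renyiDigit β (preperiodLength β + periodLength β) := by
  intro h
  obtain ⟨hL, hp⟩ := periodLength_spec hper
  rcases Nat.eq_zero_or_pos (preperiodLength β) with h0 | hpos
  · rw [h0, zero_add, renyiDigit] at h
    obtain ⟨l, hl⟩ := Nat.exists_eq_add_of_le' hL
    have := renyiDigit_succ_nonneg hβ l
    rw [← hl] at this
    omega
  · have hle : preperiodLength β ≤ preperiodLength β - 1 := by
      refine Nat.sInf_le ⟨periodLength β, hL, fun i hi => ?_⟩
      rcases eq_or_ne i (preperiodLength β) with rfl | hne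
      · exact h.symm
      · exact hp i (by omega)
    omega

end NonSimple

/-- The coefficients of the Parry polynomial are, up to sign, the digits or digit differences whose
squares are summed in the lacunarity condition. -/
lemma parryPolynomial_monic_natDegree_pos_coeffSqSum {β : ℝ} (h : IsParryNumber β) :
    (parryPolynomial β).Monic ∧ 0 < (parryPolynomial β).natDegree ∧
      coeffSqSum (parryPolynomial β) = renyiDigitSum β := by
  obtain ⟨hβ, -, hex⟩ := h
  by_cases hfin : HasFiniteExpansion β
  · have hpos := expansionLength_pos hβ hfin
    set m := expansionLength β with hmdef
    have hco : ∀ i, (parryPolynomial β).coeff i = if i ≤ m then -renyiDigit β (m - i) else 0 := by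
      intro i
      rw [parryPolynomial_eq_of_finite hfin, coeff_neg, coeff_digitPolynomial, ← hmdef]
      split_ifs <;> simp
    have hm : (parryPolynomial β).coeff m = 1 := by simp [hco, renyiDigit]
    have hdeg : (parryPolynomial β).natDegree = m := by
      refine natDegree_eq_of_le_of_coeff_ne_zero (natDegree_le_iff_coeff_eq_zero.2 fun i hi => ?_)
        (by rw [hm]; exact one_ne_zero)
      rw [hco, if_neg hi.not_ge]
    refine ⟨by rw [Monic, leadingCoeff, hdeg, hm], hdeg ▸ hpos, ?_⟩
    rw [coeffSqSum, hdeg, renyiDigitSum, if_pos hfin, ← Finset.sum_range_reflect]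
    refine Finset.sum_congr rfl fun j hj => ?_
    have := Finset.mem_range.1 hj
    rw [hco, if_pos (by omega), neg_sq]
    congr 2
    omega
  · obtain ⟨hL, -⟩ := periodLength_spec (hex.resolve_left hfin)
    set m := preperiodLength β with hmdef
    set L := periodLength β with hLdef
    have hco : ∀ j ≤ m + L, (parryPolynomial β).coeff (m + L - j) =
        (if L ≤ j then renyiDigit β (j - L) else 0) - renyiDigit β j := by
      intro j hj
      rw [parryPolynomial_eq_of_not_finite hfin, coeff_sub, coeff_digitPolynomial,
        coeff_digitPolynomial, ← hmdef, ← hLdef, if_pos (by omega : m + L - j ≤ m + L),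
        show m + L - (m + L - j) = j by omega]
      by_cases h : L ≤ j
      · rw [if_pos h, if_pos (by omega), show m - (m + L - j) = j - L by omega]
      · rw [if_neg h, if_neg (by omega)]
    have hm : (parryPolynomial β).coeff (m + L) = 1 := by
      have := hco 0 (Nat.zero_le _)
      rw [Nat.sub_zero, if_neg (by omega)] at this
      simpa [renyiDigit] using this
    have hdeg : (parryPolynomial β).natDegree = m + L := by
      refine natDegree_eq_of_le_of_coeff_ne_zero (natDegree_le_iff_coeff_eq_zero.2 fun i hi => ?_)
        (by rw [hm]; exact one_ne_zero)
      rw [parryPolynomial_eq_of_not_finite hfin, coeff_sub, coeff_digitPolynomial,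
        coeff_digitPolynomial, ← hmdef, ← hLdef, if_neg (by omega), if_neg (by omega), sub_zero]
    refine ⟨by rw [Monic, leadingCoeff, hdeg, hm], by omega, ?_⟩
    have hsq : ∀ j ∈ Finset.range (m + L + 1), (parryPolynomial β).coeff (m + L + 1 - 1 - j) ^ 2 =
        ((if L ≤ j then renyiDigit β (j - L) else 0) - renyiDigit β j) ^ 2 := fun j hj => by
      rw [Nat.add_sub_cancel, hco j (Nat.lt_succ_iff.1 (Finset.mem_range.1 hj))]
    rw [coeffSqSum, hdeg, renyiDigitSum, if_neg hfin, ← hmdef, ← hLdef,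
      ← Finset.sum_range_reflect, Finset.sum_congr rfl hsq, show m + L + 1 = L + (m + 1) by ring,
      Finset.sum_range_add, Finset.sum_range_succ' _ m, sum_Icc_one_eq_sum_range,
      add_comm (∑ j ∈ Finset.range m, _), ← add_assoc]
    congr 1
    · congr 1
      · refine Finset.sum_congr rfl fun j hj => ?_
        rw [if_neg (not_le.2 (Finset.mem_range.1 hj)), zero_sub, neg_sq]
      · rw [if_pos (Nat.le_add_right L 0), Nat.add_zero, Nat.sub_self, renyiDigit]
        ring
    · refine Finset.sum_congr rfl fun j _ => ?_
      rw [if_pos (Nat.le_add_right L _), Nat.add_sub_cancel_left]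

lemma aeval_parryPolynomial {β : ℝ} (h : IsParryNumber β) : aeval β (parryPolynomial β) = 0 := by
  obtain ⟨hβ, -, hex⟩ := h
  by_cases hfin : HasFiniteExpansion β
  · rw [parryPolynomial_eq_of_finite hfin, map_neg, aeval_digitPolynomial,
      iterate_eq_zero_of_renyiDigit_eq_zero hβ (renyiDigit_eq_zero_of_expansionLength_lt hfin),
      neg_zero, neg_zero]
  · rw [parryPolynomial_eq_of_not_finite hfin, map_sub, aeval_digitPolynomial,
      aeval_digitPolynomial,
      iterate_eq_of_renyiDigit_eq hβ (periodLength_spec (hex.resolve_left hfin)).2, sub_self]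

lemma coeff_zero_parryPolynomial_ne_zero {β : ℝ} (h : IsParryNumber β) :
    (parryPolynomial β).coeff 0 ≠ 0 := by
  obtain ⟨hβ, -, hex⟩ := h
  by_cases hfin : HasFiniteExpansion β
  · rw [parryPolynomial_eq_of_finite hfin, coeff_neg, coeff_digitPolynomial,
      if_pos (Nat.zero_le _), Nat.sub_zero, neg_ne_zero]
    exact renyiDigit_expansionLength_ne_zero hβ hfin
  · rw [parryPolynomial_eq_of_not_finite hfin, coeff_sub, coeff_digitPolynomial,
      coeff_digitPolynomial, if_pos (Nat.zero_le _), if_pos (Nat.zero_le _), Nat.sub_zero,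
      Nat.sub_zero, sub_ne_zero]
    exact renyiDigit_preperiodLength_ne hβ (hex.resolve_left hfin)

/-- `1` is a root of the Parry polynomial only if the digits sum to `1`, which forces `β` to be an
integer, or if all digits of the period vanish, which makes the expansion finite. -/
lemma eval_one_parryPolynomial_ne_zero {β : ℝ} (h : IsParryNumber β) :
    (parryPolynomial β).eval 1 ≠ 0 := by
  have haeval := aeval_parryPolynomial h
  obtain ⟨hβ, hint, hex⟩ := h
  by_cases hfin : HasFiniteExpansion β
  · have hne := renyiDigit_expansionLength_ne_zero hβ hfin
    rw [parryPolynomial_eq_of_finite hfin] at haeval ⊢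
    obtain ⟨m, hm⟩ := Nat.exists_eq_add_of_le' (expansionLength_pos hβ hfin)
    rw [hm] at haeval hne ⊢
    rw [eval_neg, neg_ne_zero, eval_one_digitPolynomial]
    have h1 := one_le_renyiDigit_one hβ
    have ht0 : renyiDigit β 0 = -1 := rfl
    rcases m with _ | m
    · rw [zero_add, map_neg, neg_eq_zero] at haeval
      simp [digitPolynomial, Finset.sum_range_succ, ht0] at haeval
      exact absurd (by linarith : β = (renyiDigit β 1 : ℤ)) (hint _)
    · have hlast := renyiDigit_succ_nonneg hβ (m + 1)
      have hmid : 0 ≤ ∑ j ∈ Finset.range m, renyiDigit β (j + 1 + 1) :=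
        Finset.sum_nonneg fun j _ => renyiDigit_succ_nonneg hβ _
      rw [Finset.sum_range_succ, Finset.sum_range_succ', Finset.sum_range_succ', ht0]
      have : 0 < renyiDigit β (m + 1 + 1) := lt_of_le_of_ne hlast hne.symm
      simp only [zero_add] at h1 ⊢
      linarith
  · obtain ⟨hL, hp⟩ := periodLength_spec (hex.resolve_left hfin)
    rw [parryPolynomial_eq_of_not_finite hfin, eval_sub, eval_one_digitPolynomial,
      eval_one_digitPolynomial]
    set m := preperiodLength β
    set L := periodLength β
    intro h0
    rw [show m + L + 1 = (m + 1) + L by ring, Finset.sum_range_add _ (m + 1) L, sub_add_cancel_left,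
      neg_eq_zero, Finset.sum_eq_zero_iff_of_nonneg] at h0
    · refine hfin ⟨m, fun i hi => ?_⟩
      induction i using Nat.strong_induction_on with
      | _ i ih =>
        by_cases hiL : i < m + 1 + L
        · have := h0 (i - (m + 1)) (Finset.mem_range.2 (by omega))
          rwa [show m + 1 + (i - (m + 1)) = i by omega] at this
        · rw [show i = (i - L) + L by omega, hp (i - L) (by omega)]
          exact ih _ (by omega) (by omega)
    · intro j _
      rw [show m + 1 + j = m + j + 1 by ring]
      exact renyiDigit_succ_nonneg hβ _

/-! ### Non-reciprocal factors -/

lemma mem_normalizedFactors_of_monic {p q : ℤ[X]} (hp : p.Monic)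
    (hq : q ∈ UniqueFactorizationMonoid.normalizedFactors p) : q.Monic := by
  obtain ⟨r, hr⟩ := UniqueFactorizationMonoid.dvd_of_mem_normalizedFactors hq
  have hu : IsUnit q.leadingCoeff := by
    refine IsUnit.of_mul_eq_one r.leadingCoeff ?_
    rw [← leadingCoeff_mul, ← hr, hp.leadingCoeff]
  have hn := congrArg leadingCoeff (UniqueFactorizationMonoid.normalize_normalized_factor q hq)
  rw [leadingCoeff_normalize, normalize_eq_one.2 hu] at hn
  exact hn.symm

lemma prod_normalizedFactors_of_monic {p : ℤ[X]} (hp : p.Monic) :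
    (UniqueFactorizationMonoid.normalizedFactors p).prod = p := by
  refine eq_of_monic_of_associated ?_ hp
    (UniqueFactorizationMonoid.prod_normalizedFactors hp.ne_zero)
  have := monic_multiset_prod_of_monic (UniqueFactorizationMonoid.normalizedFactors p) id
    fun q hq => mem_normalizedFactors_of_monic hp hq
  rwa [Multiset.map_id] at this

lemma mahlerMeasure_map_multiset_prod (s : Multiset ℤ[X]) :
    (s.prod.map (Int.castRingHom ℂ)).mahlerMeasure =
      (s.map fun q => (q.map (Int.castRingHom ℂ)).mahlerMeasure).prod := by
  rw [Polynomial.map_multiset_prod, prod_mahlerMeasure_eq_mahlerMeasure_prod, Multiset.map_map]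
  rfl

lemma eval_one_reverse {A : Type*} [CommSemiring A] (q : A[X]) :
    q.reverse.eval 1 = q.eval 1 := by
  let := invertibleOne (α := A)
  have h := eval₂_reverse_mul_pow (RingHom.id A) 1 q
  simpa using h

/-- A polynomial not vanishing at `1` can agree with its reverse up to the
sign `q(0)` only if it is reciprocal. -/
lemma C_coeff_zero_mul_ne_reverse {q : ℤ[X]} (h1 : q.eval 1 ≠ 0)
    (hrec : ¬ IsReciprocalPolynomial q) : C (q.coeff 0) * q ≠ q.reverse := by
  intro h
  have he := congrArg (eval 1) h
  rw [eval_mul, eval_C, eval_one_reverse] at he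
  rw [mul_right_cancel₀ h1 (he.trans (one_mul _).symm), C_1, one_mul] at h
  exact hrec h

/-- Smyth's theorem bounds the number of non-reciprocal factors by means of the multiplicativity
of the Mahler measure. -/
theorem pow_card_nonReciprocalFactors_le {θ : ℝ} (hθ : θ ^ 3 - θ - 1 = 0) (hθ1 : 1.3247 ≤ θ)
    {p : ℤ[X]} (hp : p.Monic) (h0 : p.coeff 0 ≠ 0) (h1 : p.eval 1 ≠ 0) :
    θ ^ Multiset.card (nonReciprocalFactors p) ≤
      (p.map (Int.castRingHom ℂ)).mahlerMeasure := by
  classical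
  have hmon : ∀ q ∈ UniqueFactorizationMonoid.normalizedFactors p, q.Monic := fun q hq =>
    mem_normalizedFactors_of_monic hp hq
  have hM1 : ∀ q : ℤ[X], q.Monic → 1 ≤ (q.map (Int.castRingHom ℂ)).mahlerMeasure := fun q hq =>
    one_le_mahlerMeasure_of_one_le_norm_leadingCoeff (by rw [(hq.map _).leadingCoeff, norm_one])
  have hθM : ∀ q ∈ nonReciprocalFactors p, θ ≤ (q.map (Int.castRingHom ℂ)).mahlerMeasure := by
    intro q hq
    obtain ⟨hqn, hrec⟩ := Multiset.mem_filter.1 hq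
    have hqm := hmon q hqn
    obtain ⟨r, hr⟩ := UniqueFactorizationMonoid.dvd_of_mem_normalizedFactors hqn
    have hq0 : q.coeff 0 ≠ 0 := fun h => h0 (by rw [hr, mul_coeff_zero, h, zero_mul])
    have hq1 : q.eval 1 ≠ 0 := fun h => h1 (by rw [hr, eval_mul, h, zero_mul])
    exact le_of_one_add_le_cube hθ hθ1 (hM1 q hqm) (one_add_mahlerMeasure_le_cube hqm hq0
      (C_coeff_zero_mul_ne_reverse hq1 hrec))
  have hsplit : nonReciprocalFactors p +
      (UniqueFactorizationMonoid.normalizedFactors p).filter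
        (fun q => ¬ ¬ IsReciprocalPolynomial q) =
      UniqueFactorizationMonoid.normalizedFactors p := by
    rw [nonReciprocalFactors]
    convert! Multiset.filter_add_not _ _
  conv_rhs => rw [← prod_normalizedFactors_of_monic hp, ← hsplit]
  rw [mahlerMeasure_map_multiset_prod, Multiset.map_add, Multiset.prod_add]
  have hθ0 : (0 : ℝ) ≤ θ := le_trans (by norm_num) hθ1
  have hA : θ ^ Multiset.card (nonReciprocalFactors p) ≤
      ((nonReciprocalFactors p).map fun q => (q.map (Int.castRingHom ℂ)).mahlerMeasure).prod := by
    have := Multiset.prod_map_le_prod_map₀ (s := nonReciprocalFactors p) (fun _ => θ)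
      (fun q => (q.map (Int.castRingHom ℂ)).mahlerMeasure) (fun _ _ => hθ0) hθM
    rwa [Multiset.map_const', Multiset.prod_replicate] at this
  refine hA.trans (le_mul_of_one_le_right ((pow_nonneg hθ0 _).trans hA) ?_)
  refine Multiset.one_le_prod fun x hx => ?_
  obtain ⟨q, hq, rfl⟩ := Multiset.mem_map.1 hx
  exact hM1 q (hmon q (Multiset.mem_filter.1 hq).1)

lemma mahlerMeasure_lt_polynomialTwoNorm {p : ℤ[X]} (hp : p.Monic) (h0 : p.coeff 0 ≠ 0)
    (hdeg : 0 < p.natDegree) :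
    (p.map (Int.castRingHom ℂ)).mahlerMeasure < polynomialTwoNorm p := by
  have h := mahlerMeasure_sq_lt_sum_norm_sq (hp.map (Int.castRingHom ℂ))
    (by rw [coeff_map, eq_intCast]; exact_mod_cast h0) (by rwa [hp.natDegree_map])
  refine Real.lt_sqrt_of_sq_lt ?_
  rw [hp.natDegree_map] at h
  simpa [Complex.norm_intCast] using h

theorem card_nonReciprocalFactors_lt {θ : ℝ} (hθ : θ ^ 3 - θ - 1 = 0) (hθ1 : 1.3247 ≤ θ)
    {p : ℤ[X]} (hp : p.Monic) (h0 : p.coeff 0 ≠ 0) (h1 : p.eval 1 ≠ 0) (hdeg : 0 < p.natDegree) :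
    (Multiset.card (nonReciprocalFactors p) : ℝ) <
      Real.log (polynomialTwoNorm p) / Real.log θ := by
  have hθ2 : 1 < θ := lt_of_lt_of_le (by norm_num) hθ1
  rw [lt_div_iff₀ (Real.log_pos hθ2), ← Real.log_pow]
  exact Real.log_lt_log (pow_pos (by linarith) _)
    ((pow_card_nonReciprocalFactors_le hθ hθ1 hp h0 h1).trans_lt
      (mahlerMeasure_lt_polynomialTwoNorm hp h0 hdeg))

lemma minpoly_int_mem_nonReciprocalFactors {β : ℝ} {p : ℤ[X]} (hp : p.Monic)
    (hβ : aeval β p = 0) (hrec : ¬ IsReciprocalPolynomial (minpoly ℤ β)) :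
    minpoly ℤ β ∈ nonReciprocalFactors p := by
  classical
  have hint : IsIntegral ℤ β := ⟨p, hp, hβ⟩
  rw [nonReciprocalFactors]
  refine Multiset.mem_filter.2 ⟨?_, hrec⟩
  exact (UniqueFactorizationMonoid.mem_normalizedFactors_iff' hp.ne_zero).2
    ⟨minpoly.irreducible hint, (minpoly.monic hint).normalize_eq_self,
      minpoly.isIntegrallyClosed_dvd hint hβ⟩

theorem mainTheorem6 :
    ∃ θ₀ : ℝ,
      IsLeast {θ : ℝ | IsPisotNumber θ} θ₀ ∧
      (θ₀ ^ 3 - θ₀ - 1 = 0 ∧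
        ∀ z : ℂ, z ^ 3 - z - 1 = 0 → z ≠ (θ₀ : ℂ) → ‖z‖ < θ₀) ∧
      (1.3247 ≤ θ₀ ∧ θ₀ < 1.3248) ∧
      (∀ β : ℝ, IsParryNumber β →
        (Multiset.card (nonReciprocalFactors (parryPolynomial β)) : ℝ) <
          Real.log (polynomialTwoNorm (parryPolynomial β)) / Real.log θ₀) ∧
      (∀ β : ℝ, IsParryNumber β →
        ¬ IsReciprocalPolynomial (minpoly ℤ β) →
        (renyiDigitSum β : ℝ) ≤ θ₀ ^ 4 →
        nonReciprocalFactors (parryPolynomial β) = {minpoly ℤ β}) := by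
  obtain ⟨θ, hθ, hlo, hhi⟩ := exists_root_cube_sub_self_sub_one
  have hθ1 : 1 < θ := lt_of_lt_of_le (by norm_num) hlo
  have hcount : ∀ β : ℝ, IsParryNumber β →
      (Multiset.card (nonReciprocalFactors (parryPolynomial β)) : ℝ) <
        Real.log (polynomialTwoNorm (parryPolynomial β)) / Real.log θ := fun β h => by
    obtain ⟨hm, hdeg, -⟩ := parryPolynomial_monic_natDegree_pos_coeffSqSum h
    exact card_nonReciprocalFactors_lt hθ hlo hm (coeff_zero_parryPolynomial_ne_zero h)
      (eval_one_parryPolynomial_ne_zero h) hdeg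
  refine ⟨θ, ⟨isPisotNumber_of_cube_sub_self_sub_one hθ hlo hhi, fun x hx =>
    le_of_one_add_le_cube hθ hlo hx.1.le hx.one_add_le_cube⟩,
    ⟨hθ, fun z hz hne => (norm_lt_one_of_cube_sub_self_sub_one hθ hlo hhi hz hne).trans hθ1⟩,
    ⟨hlo, hhi⟩, hcount, fun β h hrec hsum => ?_⟩
  obtain ⟨hm, hdeg, hnorm⟩ := parryPolynomial_monic_natDegree_pos_coeffSqSum h
  have hmem := minpoly_int_mem_nonReciprocalFactors hm (aeval_parryPolynomial h) hrec
  have hN : polynomialTwoNorm (parryPolynomial β) ≤ θ ^ 2 := by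
    have hsq : polynomialTwoNorm (parryPolynomial β) ^ 2 ≤ (θ ^ 2) ^ 2 := by
      rw [polynomialTwoNorm_sq, hnorm]
      exact hsum.trans_eq (by ring)
    exact (pow_le_pow_iff_left₀ (Real.sqrt_nonneg _) (by positivity) two_ne_zero).1 hsq
  have hpos : 0 < polynomialTwoNorm (parryPolynomial β) :=
    lt_of_le_of_lt (mahlerMeasure_nonneg _) (mahlerMeasure_lt_polynomialTwoNorm hm
      (coeff_zero_parryPolynomial_ne_zero h) hdeg)
  have hlog := Real.log_le_log hpos hN
  rw [Real.log_pow] at hlog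
  have hlt := (hcount β h).trans_le (div_le_div_of_nonneg_right hlog (Real.log_pos hθ1).le)
  rw [mul_div_assoc, div_self (Real.log_pos hθ1).ne', mul_one] at hlt
  have hcard : Multiset.card (nonReciprocalFactors (parryPolynomial β)) < 2 := by exact_mod_cast hlt
  have hpos' := Multiset.card_pos_iff_exists_mem.2 ⟨_, hmem⟩
  obtain ⟨q, hq⟩ := Multiset.card_eq_one.1 (show
    Multiset.card (nonReciprocalFactors (parryPolynomial β)) = 1 by omega)
  rw [hq, Multiset.mem_singleton] at hmem
  rw [hq, hmem]
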